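/- Let $(M^{2m},g,J)$ be a Kähler–Einstein manifold with negative Einstein constant, and let $\nabla$ be its Levi-Civita connection. For an endomorphism field $h$ of $TM$ and a $TM$-valued $2$-form $\alpha$ define the divergences $\delta h=-\sum_i(\nabla_{e_i}h)e_i$ and $\delta\alpha=-\sum_i(\nabla_{e_i}\alpha)(e_i,\cdot)$, where $\{e_i\}$ is a local $g$-orthonormal frame, and let $\mathrm{Sym}^{2,-}TM$ be the bundle of $g$-symmetric endomorphisms $h$ of $TM$ with $hJ=-Jh$. Let $\mathrm{TT}^-(M,g)$ be the space of smooth sections $h$ of $\mathrm{Sym}^{2,-}TM$ with $\delta h=0$ and $\mathrm{tr}(h)=0$. For a smooth section $h$ of $\mathrm{Sym}^{2,-}TM$ let $$[h,h]^{\mathrm{FN}}(X,Y)=-h^2[X,Y]+h([hX,Y]+[X,hY])-[hX,hY]$$ be its Frölicher–Nijenhuis bracket. The Kodaira–Spencer bracket $[h,h]^c$ is the component of $[h,h]^{\mathrm{FN}}$ in $\lambda^2_-(M,TM)$, that is $$[h,h]^c(X,Y)=\tfrac12\big(\gamma(X,Y)+J\gamma(X,JY)\big),\qquad \gamma(X,Y)=\tfrac12\big([h,h]^{\mathrm{FN}}(X,Y)-[h,h]^{\mathrm{FN}}(JX,JY)\big),$$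 and the perturbed Kodaira–Spencer bracket is $$[h,h]^c_{\mathrm{TT}}=[h,h]^c+\tfrac12\big(\delta h\wedge h-\delta(Jh)\wedge Jh\big),$$ where $(X\wedge h)(Y,Z)=g(X,Y)hZ-g(X,Z)hY$. For a $TM$-valued $2$-form $\alpha$ let $\mathrm a(\alpha)(X,Y,Z)=g(\alpha(X,Y),Z)+g(\alpha(Y,Z),X)+g(\alpha(Z,X),Y)$ be its total antisymmetrisation. Then for every smooth section $h$ of $\mathrm{Sym}^{2,-}TM$: (i) $\delta[h,h]^c_{\mathrm{TT}}$ belongs to $\mathrm{TT}^-(M,g)$; (ii) $\mathrm a\,[h,h]^c=0$ and $\mathrm a\,[h,h]^c_{\mathrm{TT}}=0$; (iii) if moreover $\delta h=0$, then $\delta[h,h]^c$ belongs to $\mathrm{TT}^-(M,g)$. -/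

import Mathlib

open Bundle Manifold ContDiff

set_option linter.unusedSectionVars false
set_option linter.unusedVariables false

noncomputable section

namespace KaehlerBracket

section Hom
variable {E : Type*} [NormedAddCommGroup E] [NormedSpace ℝ E] [FiniteDimensional ℝ E]
  {H : Type*} [TopologicalSpace H] {I : ModelWithCorners ℝ E H}
  {M : Type*} [TopologicalSpace M] [ChartedSpace H M] [IsManifold I ∞ M]
  {F : Type*} [NormedAddCommGroup F] [NormedSpace ℝ F]
  {W : M → Type*} [TopologicalSpace (TotalSpace F W)]
  [∀ x, AddCommGroup (W x)] [∀ x, Module ℝ (W x)]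
  [∀ x : M, TopologicalSpace (W x)]
  [∀ x, IsTopologicalAddGroup (W x)] [∀ x, ContinuousSMul ℝ (W x)]
  [FiberBundle F W] [VectorBundle ℝ F W]

variable (F) in
/-- The section `σ` of the bundle `Hom(TM, W)` is differentiable at `x`. -/
def MDiffHomAt (σ : Π x : M, TangentSpace I x →L[ℝ] W x) (x : M) : Prop :=
  MDifferentiableAt I (I.prod 𝓘(ℝ, E →L[ℝ] F))
    (fun y ↦ TotalSpace.mk' (E →L[ℝ] F) (E := fun x : M ↦ TangentSpace I x →L[ℝ] W x) y (σ y)) x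

variable (F) in
/-- `(∇_X σ)(Y) = D_X (σ Y) - σ (∇_X Y)`, evaluated at `x`. -/
def homAux (cov : CovariantDerivative I E (TangentSpace I : M → Type _))
    (D : CovariantDerivative I F W) (σ : Π x : M, TangentSpace I x →L[ℝ] W x)
    (x : M) (X Y : Π x : M, TangentSpace I x) : W x :=
  D (fun y ↦ σ y (Y y)) x (X x) - σ x (cov Y x (X x))


variable {cov : CovariantDerivative I E (TangentSpace I : M → Type _)}
    {D : CovariantDerivative I F W}

theorem homAux_tensorial₁ (σ : Π x : M, TangentSpace I x →L[ℝ] W x) (x : M)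
    (Y : Π x : M, TangentSpace I x) : TensorialAt I E (homAux F cov D σ x · Y) x where
  smul _ _ := by simp [homAux, smul_sub]
  add _ _ := by simp [homAux]; abel

theorem homAux_tensorial₂ {σ : Π x : M, TangentSpace I x →L[ℝ] W x} {x : M}
    (hσ : MDiffHomAt F σ x) (X : Π x : M, TangentSpace I x) :
    TensorialAt I E (homAux F cov D σ x X) x where
  smul {f Y} hf hY := by
    have h1 := D.isCovariantDerivativeOn.leibniz (s := Set.univ)
      (MDifferentiableAt.clm_bundle_apply hσ hY) hf
    have h2 : (fun y ↦ σ y ((f • Y) y)) = f • (fun y ↦ σ y (Y y)) := by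
      ext y; simp
    simp only [homAux, h2, h1, cov.isCovariantDerivativeOn.leibniz hY hf]
    simp [smul_sub]
  add {Y Y'} hY hY' := by
    have h1 := D.isCovariantDerivativeOn.add (s := Set.univ)
      (MDifferentiableAt.clm_bundle_apply hσ hY) (MDifferentiableAt.clm_bundle_apply hσ hY')
    have h2 : (fun y ↦ σ y ((Y + Y') y)) = (fun y ↦ σ y (Y y)) + (fun y ↦ σ y (Y' y)) := by
      ext y; simp
    simp only [homAux, h2, h1, cov.isCovariantDerivativeOn.add hY hY']
    simp; abel

open scoped Classical in
/-- The induced covariant derivative `∇σ` of a section `σ` of `Hom(TM, W)`; the first argument of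
the result is the direction of differentiation. Where `σ` is not differentiable it is set to `0`. -/
def homFun (cov : CovariantDerivative I E (TangentSpace I : M → Type _))
    (D : CovariantDerivative I F W) (σ : Π x : M, TangentSpace I x →L[ℝ] W x) (x : M) :
    TangentSpace I x →L[ℝ] TangentSpace I x →L[ℝ] W x :=
  if hσ : MDiffHomAt F σ x then
    TensorialAt.mkHom₂ (homAux F cov D σ x) x
      (fun Y _ ↦ homAux_tensorial₁ σ x Y) (fun X _ ↦ homAux_tensorial₂ hσ X)
  else 0

theorem homFun_apply {σ : Π x : M, TangentSpace I x →L[ℝ] W x} {x : M}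
    (hσ : MDiffHomAt F σ x) {X Y : Π x : M, TangentSpace I x}
    (hX : MDiffAt (T% X) x) (hY : MDiffAt (T% Y) x) :
    homFun cov D σ x (X x) (Y x) = D (fun y ↦ σ y (Y y)) x (X x) - σ x (cov Y x (X x)) := by
  rw [homFun, dif_pos hσ, TensorialAt.mkHom₂_apply _ _ hX hY]; rfl

variable (cov D) in
/-- The connection on `Hom(TM, W)` induced by connections on `TM` and `W`. -/
def homCov : CovariantDerivative I (E →L[ℝ] F) (fun x : M ↦ TangentSpace I x →L[ℝ] W x) where
  toFun := homFun cov D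
  isCovariantDerivativeOnUniv :=
    { add := by
        intro σ τ x hσ hτ _
        have hs : MDiffHomAt F (σ + τ) x := mdifferentiableAt_add_section hσ hτ
        ext X Y
        obtain ⟨X, hX, rfl⟩ : ∃ X' : Π x : M, TangentSpace I x, MDiffAt (T% X') x ∧ X' x = X :=
          ⟨FiberBundle.extend E X, FiberBundle.mdifferentiableAt_extend .., by simp⟩
        obtain ⟨Y, hY, rfl⟩ : ∃ X' : Π x : M, TangentSpace I x, MDiffAt (T% X') x ∧ X' x = Y :=
          ⟨FiberBundle.extend E Y, FiberBundle.mdifferentiableAt_extend .., by simp⟩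
        have h1 := D.isCovariantDerivativeOn.add (s := Set.univ)
          (MDifferentiableAt.clm_bundle_apply hσ hY) (MDifferentiableAt.clm_bundle_apply hτ hY)
        have h2 : (fun y ↦ (σ + τ) y (Y y)) = (fun y ↦ σ y (Y y)) + (fun y ↦ τ y (Y y)) := by
          ext y; simp
        simp only [add_apply]
        rw [homFun_apply hs hX hY, homFun_apply hσ hX hY, homFun_apply hτ hX hY, h2, h1]
        simp; abel
      leibniz := by
        intro σ f x hσ hf _
        have hs : MDiffHomAt F (f • σ) x := hf.smul_section hσ
        ext X Y
        obtain ⟨X, hX, rfl⟩ : ∃ X' : Π x : M, TangentSpace I x, MDiffAt (T% X') x ∧ X' x = X :=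
          ⟨FiberBundle.extend E X, FiberBundle.mdifferentiableAt_extend .., by simp⟩
        obtain ⟨Y, hY, rfl⟩ : ∃ X' : Π x : M, TangentSpace I x, MDiffAt (T% X') x ∧ X' x = Y :=
          ⟨FiberBundle.extend E Y, FiberBundle.mdifferentiableAt_extend .., by simp⟩
        have h1 := D.isCovariantDerivativeOn.leibniz (s := Set.univ)
          (MDifferentiableAt.clm_bundle_apply hσ hY) hf
        have h2 : (fun y ↦ (f • σ) y (Y y)) = f • (fun y ↦ σ y (Y y)) := by
          ext y; simp
        rw [homFun_apply hs hX hY, h2, h1]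
        simp [homFun_apply (F := F) hσ hX hY, smul_sub]
        abel }
end Hom

section Riemannian
variable {E : Type*} [NormedAddCommGroup E] [NormedSpace ℝ E] [FiniteDimensional ℝ E]
  [CompleteSpace E]
  {H : Type*} [TopologicalSpace H] {I : ModelWithCorners ℝ E H}
  {M : Type*} [TopologicalSpace M] [ChartedSpace H M] [IsManifold I ∞ M]
  [RiemannianBundle (fun x : M ↦ TangentSpace I x)]
  [IsContMDiffRiemannianBundle I ∞ E (fun x : M ↦ TangentSpace I x)]

open VectorField

theorem mdiff_inner {X Y : Π x : M, TangentSpace I x} {x : M}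
    (hX : MDiffAt (T% X) x) (hY : MDiffAt (T% Y) x) :
    MDiffAt (fun y ↦ inner ℝ (X y) (Y y)) x :=
  MDifferentiableAt.inner_bundle (IB := I) (F := E) (E := fun x : M ↦ TangentSpace I x) hX hY

/-- The right-hand side of the Koszul formula for `g(∇_X Y, Z)` at `x`. -/
def koszul (Y : Π x : M, TangentSpace I x) (x : M) (X Z : Π x : M, TangentSpace I x) : ℝ :=
  (1 / 2 : ℝ) * (d% (fun y ↦ inner ℝ (Y y) (Z y)) x (X x) + d% (fun y ↦ inner ℝ (X y) (Z y)) x (Y x)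
    - d% (fun y ↦ inner ℝ (X y) (Y y)) x (Z x) + inner ℝ (mlieBracket I X Y x) (Z x)
    - inner ℝ (mlieBracket I X Z x) (Y x) - inner ℝ (mlieBracket I Y Z x) (X x))

theorem koszul_tensorial₁ {Y Z : Π x : M, TangentSpace I x} {x : M}
    (hY : MDiffAt (T% Y) x) (hZ : MDiffAt (T% Z) x) :
    TensorialAt I E (koszul Y x · Z) x where
  smul {f X} hf hX := by
    simp [koszul, inner_smul_left, mvfderiv_fun_mul hf (mdiff_inner hX hZ),
      mvfderiv_fun_mul hf (mdiff_inner hX hY), mlieBracket_smul_left hf hX, inner_add_left,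
      inner_smul_right]
    ring
  add {X X'} hX hX' := by
    simp [koszul, inner_add_left, mvfderiv_fun_add (mdiff_inner hX hZ) (mdiff_inner hX' hZ),
      mvfderiv_fun_add (mdiff_inner hX hY) (mdiff_inner hX' hY), mlieBracket_add_left hX hX',
      inner_add_right]
    ring

theorem koszul_tensorial₂ {Y X : Π x : M, TangentSpace I x} {x : M}
    (hY : MDiffAt (T% Y) x) (hX : MDiffAt (T% X) x) :
    TensorialAt I E (koszul Y x X) x where
  smul {f Z} hf hZ := by
    simp [koszul, inner_smul_left, mvfderiv_fun_mul hf (mdiff_inner hX hZ),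
      mvfderiv_fun_mul hf (mdiff_inner hY hZ), mlieBracket_smul_right hf hZ, inner_add_left,
      inner_smul_right]
    rw [real_inner_comm (X x) (Z x), real_inner_comm (Y x) (Z x)]
    ring
  add {Z Z'} hZ hZ' := by
    simp [koszul, inner_add_left, mvfderiv_fun_add (mdiff_inner hX hZ) (mdiff_inner hX hZ'),
      mvfderiv_fun_add (mdiff_inner hY hZ) (mdiff_inner hY hZ'), mlieBracket_add_right hZ hZ',
      inner_add_right]
    ring

open scoped Classical in
/-- `∇Y` at `x`, defined by the Koszul formula and the metric; where `Y` is not differentiable it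
is set to `0`. -/
def leviCivitaFun (Y : Π x : M, TangentSpace I x) (x : M) :
    TangentSpace I x →L[ℝ] TangentSpace I x :=
  haveI : FiniteDimensional ℝ (TangentSpace I x) := inferInstanceAs (FiniteDimensional ℝ E)
  haveI : CompleteSpace (TangentSpace I x) := FiniteDimensional.complete ℝ _
  if hY : MDiffAt (T% Y) x then
    LinearMap.toContinuousLinearMap
      { toFun := fun X ↦ (InnerProductSpace.toDual ℝ (TangentSpace I x)).symm
          (TensorialAt.mkHom₂ (koszul Y x) x (fun _ hZ ↦ koszul_tensorial₁ hY hZ)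
            (fun _ hX ↦ koszul_tensorial₂ hY hX) X)
        map_add' := fun X X' ↦ by simp
        map_smul' := fun c X ↦ by simp }
  else 0

theorem inner_leviCivitaFun {X Y Z : Π x : M, TangentSpace I x} {x : M}
    (hX : MDiffAt (T% X) x) (hY : MDiffAt (T% Y) x) (hZ : MDiffAt (T% Z) x) :
    inner ℝ (leviCivitaFun Y x (X x)) (Z x) = koszul Y x X Z := by
  rw [leviCivitaFun, dif_pos hY]
  simp [TensorialAt.mkHom₂_apply _ _ hX hZ]

theorem ext_fields {A B : Π x : M, TangentSpace I x →L[ℝ] TangentSpace I x} {x : M}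
    (h : ∀ X Z : Π x : M, TangentSpace I x, MDiffAt (T% X) x → MDiffAt (T% Z) x →
      inner ℝ (A x (X x)) (Z x) = inner ℝ (B x (X x)) (Z x)) : A x = B x := by
  ext X
  refine ext_inner_right ℝ fun Z ↦ ?_
  simpa using h (FiberBundle.extend E X) (FiberBundle.extend E Z)
    (FiberBundle.mdifferentiableAt_extend ..) (FiberBundle.mdifferentiableAt_extend ..)

variable (I M) in
/-- The Levi-Civita connection `∇^g`. -/
def leviCivita : CovariantDerivative I E (TangentSpace I : M → Type _) where
  toFun := leviCivitaFun
  isCovariantDerivativeOnUniv :=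
    { add := by
        intro Y Y' x hY hY' _
        refine ext_fields (B := leviCivitaFun Y + leviCivitaFun Y') fun X Z hX hZ ↦ ?_
        simp only [Pi.add_apply, add_apply, inner_add_left]
        rw [inner_leviCivitaFun hX (mdifferentiableAt_add_section hY hY') hZ,
          inner_leviCivitaFun hX hY hZ, inner_leviCivitaFun hX hY' hZ]
        simp [koszul, inner_add_left, mvfderiv_fun_add (mdiff_inner hY hZ) (mdiff_inner hY' hZ),
          mvfderiv_fun_add (mdiff_inner hX hY) (mdiff_inner hX hY'),
          mlieBracket_add_right hY hY', mlieBracket_add_left hY hY', inner_add_right]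
        ring
      leibniz := by
        intro Y f x hY hf _
        refine ext_fields
          (B := fun x ↦ f x • leviCivitaFun Y x + (d% f x).smulRight (Y x)) fun X Z hX hZ ↦ ?_
        rw [inner_leviCivitaFun hX (hf.smul_section hY) hZ]
        have h1 := inner_leviCivitaFun hX hY hZ
        rw [koszul] at h1
        simp [koszul, inner_smul_left, mvfderiv_fun_mul hf (mdiff_inner hY hZ),
          mvfderiv_fun_mul hf (mdiff_inner hX hY), mlieBracket_smul_right hf hY,
          mlieBracket_smul_left hf hY, inner_add_left, inner_smul_right]
        rw [h1, real_inner_comm (X x) (Y x)]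
        ring }

theorem leviCivita_torsion : (leviCivita I M).torsion = 0 := by
  rw [CovariantDerivative.torsion_eq_zero_iff]
  intro X Y x hX hY
  refine ext_inner_right ℝ fun Z ↦ ?_
  obtain ⟨Z, hZ, rfl⟩ : ∃ Z' : Π x : M, TangentSpace I x, MDiffAt (T% Z') x ∧ Z' x = Z :=
    ⟨FiberBundle.extend E Z, FiberBundle.mdifferentiableAt_extend .., by simp⟩
  have h1 := inner_leviCivitaFun hX hY hZ
  have h2 := inner_leviCivitaFun hY hX hZ
  change inner ℝ (leviCivitaFun Y x (X x) - leviCivitaFun X x (Y x)) (Z x) = _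
  rw [inner_sub_left, h1, h2]
  have h3 : (fun y ↦ inner ℝ (X y) (Y y)) = fun y ↦ inner ℝ (Y y) (X y) := by
    ext y; rw [real_inner_comm]
  simp only [koszul, h3, mlieBracket_swap_apply (V := Y) (W := X), inner_neg_left]
  ring

theorem leviCivita_isMetricCompatible : CovariantDerivative.IsMetricCompatible
    (V := fun x : M ↦ TangentSpace I x) (leviCivita I M) := by
  rw [CovariantDerivative.isMetricCompatible_iff]
  intro x X Y Z hX hY hZ
  have h1 := inner_leviCivitaFun hX hY hZ
  have h2 := inner_leviCivitaFun hX hZ hY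
  change _ = inner ℝ (leviCivitaFun Y x (X x)) (Z x) + inner ℝ (Y x) (leviCivitaFun Z x (X x))
  rw [real_inner_comm _ (Y x), h1, h2]
  have h3 : (fun y ↦ inner ℝ (Z y) (Y y)) = fun y ↦ inner ℝ (Y y) (Z y) := by
    ext y; rw [real_inner_comm]
  simp only [koszul, h3, mlieBracket_swap_apply (V := Z) (W := Y), inner_neg_left]
  ring

/-- Fields of endomorphisms of the tangent bundle (no regularity). -/
abbrev EndField (I : ModelWithCorners ℝ E H) (M : Type*) [TopologicalSpace M] [ChartedSpace H M] :=
  Π x : M, TangentSpace I x →L[ℝ] TangentSpace I x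

/-- Bilinear bundle maps `TM × TM → TM` (no regularity). -/
abbrev TwoField (I : ModelWithCorners ℝ E H) (M : Type*) [TopologicalSpace M] [ChartedSpace H M] :=
  Π x : M, TangentSpace I x →L[ℝ] TangentSpace I x →L[ℝ] TangentSpace I x

/-- `h` is a smooth section of `End(TM)`. -/
def IsSmoothEnd (h : EndField I M) : Prop :=
  ContMDiff I (I.prod 𝓘(ℝ, E →L[ℝ] E)) ∞
    (fun x ↦ TotalSpace.mk' (E →L[ℝ] E)
      (E := fun x : M ↦ TangentSpace I x →L[ℝ] TangentSpace I x) x (h x))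

/-- `-h²[X,Y] + h([hX,Y] + [X,hY]) - [hX,hY]` at `x`. -/
def fnAux (h : EndField I M) (x : M) (X Y : Π x : M, TangentSpace I x) : TangentSpace I x :=
  -h x (h x (mlieBracket I X Y x))
    + h x (mlieBracket I (fun y ↦ h y (X y)) Y x + mlieBracket I X (fun y ↦ h y (Y y)) x)
    - mlieBracket I (fun y ↦ h y (X y)) (fun y ↦ h y (Y y)) x

theorem fnAux_swap (h : EndField I M) (x : M) (X Y : Π x : M, TangentSpace I x) :
    fnAux h x X Y = - fnAux h x Y X := by
  simp only [fnAux, mlieBracket_swap_apply (V := Y), mlieBracket_swap_apply (V := fun y ↦ h y (Y y)),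
    map_neg, map_add]
  abel

theorem fnAux_tensorial₁ {h : EndField I M} {x : M} (hh : MDiffHomAt E h x)
    {Y : Π x : M, TangentSpace I x} (hY : MDiffAt (T% Y) x) :
    TensorialAt I E (fnAux h x · Y) x where
  smul {f X} hf hX := by
    have e : (fun y ↦ h y ((f • X) y)) = f • (fun y ↦ h y (X y)) := by ext y; simp
    have hX' : MDiffAt (T% (fun y ↦ h y (X y))) x := MDifferentiableAt.clm_bundle_apply hh hX
    simp only [fnAux, e, mlieBracket_smul_left hf hX, mlieBracket_smul_left hf hX']
    simp [smul_add, smul_sub]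
    abel
  add {X X'} hX hX' := by
    have e : (fun y ↦ h y ((X + X') y)) = (fun y ↦ h y (X y)) + (fun y ↦ h y (X' y)) := by
      ext y; simp
    have hhX : MDiffAt (T% (fun y ↦ h y (X y))) x := MDifferentiableAt.clm_bundle_apply hh hX
    have hhX' : MDiffAt (T% (fun y ↦ h y (X' y))) x := MDifferentiableAt.clm_bundle_apply hh hX'
    simp only [fnAux, e, mlieBracket_add_left hX hX', mlieBracket_add_left hhX hhX']
    simp
    abel

theorem fnAux_tensorial₂ {h : EndField I M} {x : M} (hh : MDiffHomAt E h x)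
    {X : Π x : M, TangentSpace I x} (hX : MDiffAt (T% X) x) :
    TensorialAt I E (fnAux h x X) x where
  smul {f Y} hf hY := by
    rw [fnAux_swap, (fnAux_tensorial₁ hh hX).smul hf hY, fnAux_swap h x X Y, smul_neg]
  add {Y Y'} hY hY' := by
    rw [fnAux_swap, (fnAux_tensorial₁ hh hX).add hY hY', fnAux_swap h x X Y, fnAux_swap h x X Y',
      neg_add]

open scoped Classical in
/-- The Frölicher–Nijenhuis bracket `[h,h]^FN`, as a tensor; set to `0` where `h` is not
differentiable. -/
def fnBracket (h : EndField I M) : TwoField I M := fun x ↦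
  if hh : MDiffHomAt E h x then
    TensorialAt.mkHom₂ (fnAux h x) x (fun _ hY ↦ fnAux_tensorial₁ hh hY)
      (fun _ hX ↦ fnAux_tensorial₂ hh hX)
  else 0

theorem fnBracket_apply {h : EndField I M} {x : M} (hh : MDiffHomAt E h x)
    {X Y : Π x : M, TangentSpace I x} (hX : MDiffAt (T% X) x) (hY : MDiffAt (T% Y) x) :
    fnBracket h x (X x) (Y x) =
      -h x (h x (mlieBracket I X Y x))
        + h x (mlieBracket I (fun y ↦ h y (X y)) Y x + mlieBracket I X (fun y ↦ h y (Y y)) x)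
        - mlieBracket I (fun y ↦ h y (X y)) (fun y ↦ h y (Y y)) x := by
  rw [fnBracket, dif_pos hh, TensorialAt.mkHom₂_apply _ _ hX hY]; rfl

/-- `∇h` for `h` a field of endomorphisms: `nablaEnd h x X Y = (∇_X h) Y`. -/
def nablaEnd (h : EndField I M) : TwoField I M := homCov (leviCivita I M) (leviCivita I M) h

/-- `∇α`: `nablaTwo α x X Y Z = (∇_X α)(Y, Z)`. -/
def nablaTwo (α : TwoField I M) (x : M) :
    TangentSpace I x →L[ℝ] TangentSpace I x →L[ℝ] TangentSpace I x →L[ℝ] TangentSpace I x :=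
  homCov (leviCivita I M) (homCov (leviCivita I M) (leviCivita I M)) α x

instance finiteDimensional_tangentSpace (x : M) : FiniteDimensional ℝ (TangentSpace I x) := inferInstanceAs (FiniteDimensional ℝ E)

/-- The divergence `δh = -∑ᵢ (∇_{eᵢ} h) eᵢ`, as a vector field. -/
def divEnd (h : EndField I M) (x : M) : TangentSpace I x :=
  -∑ i, nablaEnd h x (stdOrthonormalBasis ℝ (TangentSpace I x) i)
    (stdOrthonormalBasis ℝ (TangentSpace I x) i)

/-- The divergence `δα = -∑ᵢ (∇_{eᵢ} α)(eᵢ, ·)`. -/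
def divTwo (α : TwoField I M) : EndField I M := fun x ↦
  -∑ i, nablaTwo α x (stdOrthonormalBasis ℝ (TangentSpace I x) i)
    (stdOrthonormalBasis ℝ (TangentSpace I x) i)

/-- The second covariant derivative: `hess Z x X Y = ∇²_{X,Y} Z`. -/
def hess (Z : Π x : M, TangentSpace I x) : TwoField I M := nablaEnd (leviCivita I M Z)

/-- The curvature `R(X,Y)Z = ∇²_{Y,X} Z - ∇²_{X,Y} Z`. -/
def curvature (x : M) (X Y Z : TangentSpace I x) : TangentSpace I x :=
  hess (FiberBundle.extend E Z) x Y X - hess (FiberBundle.extend E Z) x X Y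

/-- The Ricci endomorphism `Ric X = ∑ᵢ R(eᵢ, X) eᵢ` (positive on round spheres). -/
def ricci (x : M) (X : TangentSpace I x) : TangentSpace I x :=
  ∑ i, curvature x (stdOrthonormalBasis ℝ (TangentSpace I x) i) X
    (stdOrthonormalBasis ℝ (TangentSpace I x) i)

variable (I M) in
/-- The metric is Einstein with Einstein constant `c`. -/
def IsEinstein (c : ℝ) : Prop := ∀ (x : M) (X : TangentSpace I x), ricci x X = c • X

/-- `J` is a complex structure that makes the Riemannian manifold `M` Kähler: a smooth orthogonal
almost complex structure with `∇^g J = 0`. -/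
structure IsKaehler (J : EndField I M) : Prop where
  smooth : IsSmoothEnd J
  sq : ∀ (x : M) (X : TangentSpace I x), J x (J x X) = -X
  isometry : ∀ (x : M) (X Y : TangentSpace I x), inner ℝ (J x X) (J x Y) = inner ℝ X Y
  parallel : ∀ x : M, nablaEnd J x = 0

/-- The smooth sections of `Sym² TM`. -/
def symTensors (I : ModelWithCorners ℝ E H) (M : Type*) [TopologicalSpace M] [ChartedSpace H M]
    [IsManifold I ∞ M] [RiemannianBundle (fun x : M ↦ TangentSpace I x)] : Set (EndField I M) :=
  {h | IsSmoothEnd h ∧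
    ∀ (x : M) (X Y : TangentSpace I x), inner ℝ (h x X) Y = inner ℝ X (h x Y)}

/-- The smooth sections of `Sym^{2,-} TM`: those `h` in `Sym² TM` with `hJ = -Jh`. -/
def symMinus (J : EndField I M) : Set (EndField I M) :=
  {h | h ∈ symTensors I M ∧ ∀ (x : M) (X : TangentSpace I x), h x (J x X) = -J x (h x X)}

variable (I M) in
/-- The `TT`-tensors: symmetric, divergence-free and trace-free. -/
def ttTensors : Set (EndField I M) :=
  {h | h ∈ symTensors I M ∧ (∀ x : M, divEnd h x = 0) ∧
    ∀ x : M, LinearMap.trace ℝ (TangentSpace I x) (h x : TangentSpace I x →ₗ[ℝ] TangentSpace I x) = 0}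

/-- The `J`-anti-invariant `TT`-tensors. -/
def ttMinus (J : EndField I M) : Set (EndField I M) := ttTensors I M ∩ symMinus J

/-- The component `(α - α(J·,J·))/2` of `α` in `λ²(M, TM)`. -/
def antiPart (J : EndField I M) (α : TwoField I M) : TwoField I M := fun x ↦
  (1 / 2 : ℝ) • (α x - (α x).bilinearComp (J x) (J x))

/-- The component `γ_-(X,Y) = (γ(X,Y) + Jγ(X,JY))/2` in `λ²_-(M, TM)` of `γ` in `λ²(M, TM)`. -/
def minusPart (J : EndField I M) (γ : TwoField I M) : TwoField I M := fun x ↦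
  (1 / 2 : ℝ) • (γ x + (ContinuousLinearMap.postcomp (TangentSpace I x) (J x)) ∘L
    ((γ x).bilinearComp (.id ℝ (TangentSpace I x)) (J x)))

/-- `(X ∧ h)(Y,Z) = g(X,Y) hZ - g(X,Z) hY`. -/
def wedge (X : Π x : M, TangentSpace I x) (h : EndField I M) : TwoField I M := fun x ↦
  (innerSL ℝ (X x)).smulRight (h x) - ((innerSL ℝ (X x)).smulRight (h x)).flip

theorem antiPart_apply (J : EndField I M) (α : TwoField I M) (x : M) (X Y : TangentSpace I x) :
    antiPart J α x X Y = (1 / 2 : ℝ) • (α x X Y - α x (J x X) (J x Y)) := rfl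

theorem minusPart_apply (J : EndField I M) (γ : TwoField I M) (x : M) (X Y : TangentSpace I x) :
    minusPart J γ x X Y = (1 / 2 : ℝ) • (γ x X Y + J x (γ x X (J x Y))) := rfl

theorem wedge_apply (V : Π x : M, TangentSpace I x) (h : EndField I M) (x : M)
    (Y Z : TangentSpace I x) :
    wedge V h x Y Z = inner ℝ (V x) Y • h x Z - inner ℝ (V x) Z • h x Y := rfl

/-- The Kodaira–Spencer bracket `[h,h]^c`, the component of `[h,h]^FN` in `λ²_-(M, TM)`. -/
def ksBracket (J h : EndField I M) : TwoField I M := minusPart J (antiPart J (fnBracket h))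

/-- The composition `J ∘ h`. -/
def compEnd (J h : EndField I M) : EndField I M := fun x ↦ J x ∘L h x

/-- The perturbed Kodaira–Spencer bracket
`[h,h]^c_TT = [h,h]^c + (δh ∧ h - δ(Jh) ∧ Jh)/2`. -/
def ksBracketTT (J h : EndField I M) : TwoField I M := fun x ↦
  ksBracket J h x + (1 / 2 : ℝ) • (wedge (divEnd h) h x
    - wedge (divEnd (compEnd J h)) (compEnd J h) x)

/-- The total antisymmetrisation: the cyclic sum of `g(α(X,Y),Z)`. -/
def totalAntisymm (α : TwoField I M) (x : M) (X Y Z : TangentSpace I x) : ℝ :=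
  inner ℝ (α x X Y) Z + inner ℝ (α x Y Z) X + inner ℝ (α x Z X) Y

end Riemannian

end KaehlerBracket

end

/-! The perturbed bracket is itself a divergence. For a symmetric endomorphism field k put Ω_k(w,u)v
= g(kw,u)kv - g(kw,v)ku, and let Θ = Ω_h - Ω_{Jh} (`potential`). In δΩ_k the derivative falls either
on the contracted factor, which gives δk ∧ k, or on the other one, which gives -(∇_{ku}k)v +
(∇_{kv}k)u. Since ∇J = 0, the Kodaira–Spencer bracket is one half of the terms of the second kind
for h minus those for Jh. The wedge terms added in [h,h]^c_TT supply the rest, so [h,h]^c_TT = ½ δΘ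
(`ksBracketTT_eq`).

Hence δ[h,h]^c_TT = ½ δδΘ, a full contraction of ∇²Θ in its first four slots. The curvature of a
Kähler metric is of type (1,1), and so are the induced curvatures on the iterated bundles Hom(TM,
·). If a tensor changes sign when J is applied to both contracted slots, its contraction with such a
curvature changes sign when the frame is replaced by its image under J, and therefore vanishes. So
the two derivatives in the double divergence commute (`IsKaehler.sum_secondDeriv_comm`).

This is used twice. For Θ, together with the symmetry g(Θ(a,b)u,v) = g(Θ(b,a)v,u), it shows that
δ[h,h]^c_TT is symmetric. For the alternating form α = [h,h]^c_TT it gives δδα = -δδα = 0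
(`IsKaehler.divHom_divHom_eq_zero`). Anticommutation with J survives differentiation because J is
parallel, and it forces the trace to vanish.

Part (ii) is pointwise algebra: ∇_w h and J∇_w h are g-symmetric, so the cyclic sum cancels in
pairs. Part (iii) reduces to (i), since δh = 0 gives δ(Jh) = Jδh = 0 and the two brackets coincide.
-/

noncomputable section

namespace KaehlerBracket

open Filter Topology

/-! ### Smooth sections: cut-offs, global extensions, and a smoothness test on Hom(TM, W). -/

section SmoothSections

variable {E : Type*} [NormedAddCommGroup E] [NormedSpace ℝ E] [FiniteDimensional ℝ E]
  {H : Type*} [TopologicalSpace H] {I : ModelWithCorners ℝ E H}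
  {M : Type*} [TopologicalSpace M] [ChartedSpace H M] [IsManifold I ∞ M]
  {F : Type*} [NormedAddCommGroup F] [NormedSpace ℝ F]
  {W : M → Type*} [TopologicalSpace (TotalSpace F W)]
  [∀ x, AddCommGroup (W x)] [∀ x, Module ℝ (W x)]
  [∀ x : M, TopologicalSpace (W x)]
  [∀ x, IsTopologicalAddGroup (W x)] [∀ x, ContinuousSMul ℝ (W x)]
  [FiberBundle F W] [VectorBundle ℝ F W]

variable (I F) in
/-- The section `s` of the vector bundle `W` is smooth. -/
def IsSmoothSection (s : Π x : M, W x) : Prop :=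
  ContMDiff I (I.prod 𝓘(ℝ, F)) ∞ (fun x ↦ TotalSpace.mk' F x (s x))

theorem IsSmoothSection.mdifferentiableAt {s : Π x : M, W x} (hs : IsSmoothSection I F s) (x : M) :
    MDifferentiableAt I (I.prod 𝓘(ℝ, F)) (fun x ↦ TotalSpace.mk' F x (s x)) x :=
  (hs x).mdifferentiableAt (by simp)

theorem IsSmoothSection.sub {s t : Π x : M, W x} (hs : IsSmoothSection I F s)
    (ht : IsSmoothSection I F t) : IsSmoothSection I F (fun x ↦ s x - t x) :=
  ContMDiff.sub_section hs ht

theorem IsSmoothSection.neg {s : Π x : M, W x} (hs : IsSmoothSection I F s) :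
    IsSmoothSection I F (fun x ↦ -s x) :=
  ContMDiff.neg_section hs

theorem IsSmoothSection.const_smul {s : Π x : M, W x} (c : ℝ) (hs : IsSmoothSection I F s) :
    IsSmoothSection I F (fun x ↦ c • s x) :=
  ContMDiff.const_smul_section hs

theorem IsSmoothSection.smul {f : M → ℝ} {s : Π x : M, W x} (hf : ContMDiff I 𝓘(ℝ) ∞ f)
    (hs : IsSmoothSection I F s) : IsSmoothSection I F (fun x ↦ f x • s x) :=
  ContMDiff.smul_section hf hs

theorem IsSmoothSection.sum {ι : Type*} {t : Finset ι} {s : ι → Π x : M, W x}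
    (hs : ∀ i ∈ t, IsSmoothSection I F (s i)) : IsSmoothSection I F (fun x ↦ ∑ i ∈ t, s i x) :=
  ContMDiff.sum_section hs

theorem IsSmoothSection.of_locally {s : Π x : M, W x}
    (h : ∀ x, ∃ t : Π x : M, W x, IsSmoothSection I F t ∧ ∀ᶠ y in 𝓝 x, s y = t y) :
    IsSmoothSection I F s := by
  intro x
  obtain ⟨t, ht, hst⟩ := h x
  exact (ht x).congr_of_eventuallyEq (hst.mono fun y hy ↦ by simp [hy])

theorem IsSmoothSection.apply {σ : Π x : M, TangentSpace I x →L[ℝ] W x}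
    {Y : Π x : M, TangentSpace I x} (hσ : IsSmoothSection I (E →L[ℝ] F) σ)
    (hY : IsSmoothSection I E Y) : IsSmoothSection I F (fun x ↦ σ x (Y x)) :=
  ContMDiff.clm_bundle_apply (b := id) hσ hY

/-- Multiplication by a bump function supported in U and equal to 1 near x. It turns local frames
into global fields, so that tensor identities can be tested on globally smooth sections only. -/
theorem IsSmoothSection.cutoff [T2Space M] [ContMDiffVectorBundle ∞ F W I]
    {U : Set M} (hU : IsOpen U) {s : Π x : M, W x}
    (hs : ContMDiffOn I (I.prod 𝓘(ℝ, F)) ∞ (fun x ↦ TotalSpace.mk' F x (s x)) U)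
    {x : M} (hx : x ∈ U) :
    ∃ t : Π x : M, W x, IsSmoothSection I F t ∧ ∀ᶠ y in 𝓝 x, t y = s y := by
  obtain ⟨f, -, hf⟩ := (SmoothBumpFunction.nhds_basis_tsupport (I := I) x).mem_iff.1
    (hU.mem_nhds hx)
  refine ⟨fun y ↦ f y • s y, ContMDiffOn.smul_section_of_tsupport
    (f.contMDiff.contMDiffOn) hU hf hs, ?_⟩
  filter_upwards [f.eventuallyEq_one] with y hy
  simp [hy]

theorem exists_isSmoothSection_eq [T2Space M] [ContMDiffVectorBundle ∞ F W I] (x : M) (w : F) :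
    ∃ t : Π x : M, W x, IsSmoothSection I F t ∧
      ∀ᶠ y in 𝓝 x, t y = (trivializationAt F W x).symmL ℝ y w := by
  refine IsSmoothSection.cutoff (trivializationAt F W x).open_baseSet ?_
    (FiberBundle.mem_baseSet_trivializationAt F W x)
  have h1 := (trivializationAt F W x).contMDiffOn_symmL (IB := I) (n := ∞)
  exact ContMDiffOn.clm_bundle_apply (E₁ := Bundle.Trivial M F) (b := id) h1
    (v := fun _ ↦ w) (fun y _ ↦ by
      rw [contMDiffWithinAt_totalSpace]
      exact ⟨contMDiffWithinAt_id, contMDiffWithinAt_const⟩)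

theorem exists_isSmoothSection_apply_eq [T2Space M] [ContMDiffVectorBundle ∞ F W I] (x : M)
    (w : W x) : ∃ t : Π x : M, W x, IsSmoothSection I F t ∧ t x = w := by
  obtain ⟨t, ht, hy⟩ := exists_isSmoothSection_eq (I := I) (F := F) (W := W) x
    ((trivializationAt F W x).continuousLinearMapAt ℝ x w)
  refine ⟨t, ht, ?_⟩
  rw [hy.self_of_nhds]
  exact (trivializationAt F W x).symmL_continuousLinearMapAt
    (FiberBundle.mem_baseSet_trivializationAt F W x) w

theorem contMDiffAt_clm_of_apply {f : M → E →L[ℝ] F} {x : M}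
    (h : ∀ v, ContMDiffAt I 𝓘(ℝ, F) ∞ (fun y ↦ f y v) x) :
    ContMDiffAt I 𝓘(ℝ, E →L[ℝ] F) ∞ f x := by
  let b := Module.finBasis ℝ E
  have : f = fun y ↦ ∑ i, ContinuousLinearMap.smulRightL ℝ E F
      (LinearMap.toContinuousLinearMap (b.coord i)) (f y (b i)) := by
    ext y v
    conv_lhs => rw [← b.sum_repr v, map_sum]
    simp [-Module.Basis.sum_repr]
  rw [this]
  refine ContMDiffAt.sum fun i _ ↦ ?_
  exact (ContinuousLinearMap.contMDiff _).contMDiffAt.comp x (h (b i))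

/-- A section of `Hom(TM, W)` is smooth as soon as it maps smooth vector fields to smooth
sections. -/
theorem IsSmoothSection.of_apply [T2Space M] [ContMDiffVectorBundle ∞ F W I]
    {σ : Π x : M, TangentSpace I x →L[ℝ] W x}
    (h : ∀ Y : Π x : M, TangentSpace I x, IsSmoothSection I E Y →
      IsSmoothSection I F (fun x ↦ σ x (Y x))) :
    IsSmoothSection I (E →L[ℝ] F) σ := by
  intro x
  rw [contMDiffAt_hom_bundle]
  refine ⟨contMDiffAt_id, contMDiffAt_clm_of_apply fun v ↦ ?_⟩
  -- Near x the field Y is the constant vector v in the trivialization, so σ Y read in coordinates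
  -- is the coordinate matrix of σ applied to v.
  obtain ⟨Y, hY, hYe⟩ := exists_isSmoothSection_eq (I := I) (F := E)
    (W := fun x : M ↦ TangentSpace I x) x v
  have h2 := (contMDiffAt_totalSpace.1 (h Y hY x)).2
  refine h2.congr_of_eventuallyEq ?_
  filter_upwards [hYe, (trivializationAt F W x).open_baseSet.mem_nhds
    (FiberBundle.mem_baseSet_trivializationAt F W x)] with y hy hy'
  simp [ContinuousLinearMap.inCoordinates, hy, hy']

end SmoothSections

/-! ### Smooth orthonormal frames and smoothness of the induced connections. -/

section SmoothRiemannian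
variable {E : Type*} [NormedAddCommGroup E] [NormedSpace ℝ E] [FiniteDimensional ℝ E]
  [CompleteSpace E]
  {H : Type*} [TopologicalSpace H] {I : ModelWithCorners ℝ E H}
  {M : Type*} [TopologicalSpace M] [ChartedSpace H M] [IsManifold I ∞ M]
  [RiemannianBundle (fun x : M ↦ TangentSpace I x)]
  [IsContMDiffRiemannianBundle I ∞ E (fun x : M ↦ TangentSpace I x)]

open VectorField

theorem contMDiffOn_inner {U : Set M} {X Y : Π x : M, TangentSpace I x}
    (hX : ContMDiffOn I (I.prod 𝓘(ℝ, E)) ∞ (fun x ↦ TotalSpace.mk' E x (X x)) U)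
    (hY : ContMDiffOn I (I.prod 𝓘(ℝ, E)) ∞ (fun x ↦ TotalSpace.mk' E x (Y x)) U) :
    ContMDiffOn I 𝓘(ℝ) ∞ (fun y ↦ (inner ℝ (X y) (Y y) : ℝ)) U :=
  ContMDiffOn.inner_bundle (IB := I) (F := E) (E := fun x : M ↦ TangentSpace I x) (b := id) hX hY

theorem IsSmoothSection.inner {X Y : Π x : M, TangentSpace I x}
    (hX : IsSmoothSection I E X) (hY : IsSmoothSection I E Y) :
    ContMDiff I 𝓘(ℝ) ∞ (fun y ↦ (inner ℝ (X y) (Y y) : ℝ)) :=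
  ContMDiff.inner_bundle (IB := I) (F := E) (E := fun x : M ↦ TangentSpace I x) (b := id) hX hY

/-- Induction on the index: each Gram–Schmidt vector is a rational expression in earlier ones, with
denominators that are nonzero by linear independence. -/
theorem contMDiffOn_gramSchmidt {n : ℕ} {U : Set M} {s : Fin n → Π x : M, TangentSpace I x}
    (hs : ∀ i, ContMDiffOn I (I.prod 𝓘(ℝ, E)) ∞ (fun x ↦ TotalSpace.mk' E x (s i x)) U)
    (hli : ∀ x ∈ U, LinearIndependent ℝ (fun i ↦ s i x)) (i : Fin n) :
    ContMDiffOn I (I.prod 𝓘(ℝ, E)) ∞ (fun x ↦ TotalSpace.mk' E x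
      (InnerProductSpace.gramSchmidt ℝ (fun j ↦ s j x) i)) U := by
  induction i using WellFoundedLT.induction with
  | _ i ih =>
  have h1 : ContMDiffOn I (I.prod 𝓘(ℝ, E)) ∞ (fun x ↦ TotalSpace.mk' E x
      (s i x - ∑ j ∈ Finset.Iio i,
        ((inner ℝ (InnerProductSpace.gramSchmidt ℝ (fun j ↦ s j x) j) (s i x) : ℝ) /
          (inner ℝ (InnerProductSpace.gramSchmidt ℝ (fun j ↦ s j x) j)
            (InnerProductSpace.gramSchmidt ℝ (fun j ↦ s j x) j) : ℝ)) •
          InnerProductSpace.gramSchmidt ℝ (fun j ↦ s j x) j)) U := by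
    refine ContMDiffOn.sub_section (hs i) (ContMDiffOn.sum_section fun j hj ↦ ?_)
    have hj' := ih j (Finset.mem_Iio.1 hj)
    refine ContMDiffOn.smul_section (ContMDiffOn.div₀ (contMDiffOn_inner hj' (hs i))
      (contMDiffOn_inner hj' hj') fun x hx ↦ ?_) hj'
    exact inner_self_ne_zero.2 (InnerProductSpace.gramSchmidt_ne_zero j (hli x hx))
  refine h1.congr fun x hx ↦ ?_
  congr 1
  have h2 := InnerProductSpace.gramSchmidt_def'' ℝ (fun j ↦ s j x) i
  simp only [RCLike.ofReal_real_eq_id, id] at h2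
  simp only [real_inner_self_eq_norm_sq]
  exact eq_sub_of_add_eq h2.symm

/-- Near every point there are orthonormal frames that are restrictions of smooth global vector
fields. -/
theorem exists_orthonormal_frame [T2Space M] (x : M) :
    ∃ e : Fin (Module.finrank ℝ E) → Π x : M, TangentSpace I x,
      (∀ i, IsSmoothSection I E (e i)) ∧ ∀ᶠ y in 𝓝 x, Orthonormal ℝ (fun i ↦ e i y) := by
  let t := trivializationAt E (fun x : M ↦ TangentSpace I x) x
  let s := t.localFrame (Module.finBasis ℝ E)
  have hs := t.isLocalFrameOn_localFrame_baseSet I ∞ (Module.finBasis ℝ E)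
  have hx : x ∈ t.baseSet := FiberBundle.mem_baseSet_trivializationAt E _ x
  have hg := fun i ↦ contMDiffOn_gramSchmidt hs.contMDiffOn
    (fun y hy ↦ hs.linearIndependent hy) i
  have hn : ∀ i, ContMDiffOn I (I.prod 𝓘(ℝ, E)) ∞ (fun x ↦ TotalSpace.mk' E x
      (InnerProductSpace.gramSchmidtNormed ℝ (fun j ↦ s j x) i)) t.baseSet := by
    intro i
    refine ContMDiffOn.smul_section (ContMDiffOn.inv₀ (f := fun y ↦
      ‖InnerProductSpace.gramSchmidt ℝ (fun j ↦ s j y) i‖) ?_ fun y hy ↦ ?_) (hg i)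
    -- The norm is the square root of a smooth function without zeros on the base set.
    · have h1 := contMDiffOn_inner (hg i) (hg i)
      intro y hy
      have hne := InnerProductSpace.gramSchmidt_ne_zero i (hs.linearIndependent hy)
      have h2 := ((Real.contDiffAt_sqrt (n := ∞) (inner_self_ne_zero (𝕜 := ℝ).2 hne)).contMDiffAt
        ).comp_contMDiffWithinAt y (h1 y hy)
      refine h2.congr (fun z _ ↦ ?_) ?_ <;> exact norm_eq_sqrt_real_inner _
    · exact norm_ne_zero_iff.2 (InnerProductSpace.gramSchmidt_ne_zero i (hs.linearIndependent hy))
  choose e he hee using fun i ↦ IsSmoothSection.cutoff t.open_baseSet (hn i) hx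
  refine ⟨e, he, ?_⟩
  filter_upwards [eventually_all.2 hee, t.open_baseSet.mem_nhds hx] with y hy hy'
  simp only [hy]
  exact InnerProductSpace.gramSchmidtNormed_orthonormal (hs.linearIndependent hy')

theorem contMDiff_mvfderiv_apply {f : M → ℝ} (hf : ContMDiff I 𝓘(ℝ) ∞ f)
    {X : Π x : M, TangentSpace I x} (hX : IsSmoothSection I E X) :
    ContMDiff I 𝓘(ℝ) ∞ (fun x ↦ d% f x (X x)) := by
  have h1 := (hf.contMDiff_tangentMap (m := ∞) (by simp)).comp hX
  intro x
  have h2 := (contMDiffAt_totalSpace.1 (h1 x)).2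
  simpa using! h2

theorem IsSmoothSection.mlieBracket {X Y : Π x : M, TangentSpace I x} (hX : IsSmoothSection I E X)
    (hY : IsSmoothSection I E Y) : IsSmoothSection I E (mlieBracket I X Y) := by
  have : IsManifold I ((⊤ : ℕ∞) + 1) M := inferInstanceAs (IsManifold I ∞ M)
  have : IsManifold I (minSmoothness ℝ 2) M := by
    rw [minSmoothness_of_isRCLikeNormedField]; infer_instance
  exact ContDiff.mlieBracket_vectorField (m := ⊤) (n := ⊤) hX hY (by simp)

theorem sum_inner_smul_of_orthonormal {x : M} {e : Fin (Module.finrank ℝ E) → TangentSpace I x}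
    (he : Orthonormal ℝ e) (v : TangentSpace I x) : ∑ i, inner ℝ (e i) v • e i = v := by
  have h1 : ⊤ ≤ Submodule.span ℝ (Set.range e) :=
    (he.linearIndependent.span_eq_top_of_card_eq_finrank' (by
      rw [Fintype.card_fin]; rfl)).ge
  simpa using (OrthonormalBasis.mk he h1).sum_repr' v

/-- A vector field is smooth as soon as its products with smooth vector fields are. -/
theorem IsSmoothSection.of_inner [T2Space M] {Y : Π x : M, TangentSpace I x}
    (h : ∀ Z : Π x : M, TangentSpace I x, IsSmoothSection I E Z →
      ContMDiff I 𝓘(ℝ) ∞ (fun y ↦ (Inner.inner ℝ (Z y) (Y y) : ℝ))) : IsSmoothSection I E Y := by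
  refine IsSmoothSection.of_locally fun x ↦ ?_
  obtain ⟨e, he, hon⟩ := exists_orthonormal_frame (I := I) x
  refine ⟨fun y ↦ ∑ i, Inner.inner ℝ (e i y) (Y y) • e i y,
    IsSmoothSection.sum fun i _ ↦ IsSmoothSection.smul (h _ (he i)) (he i), ?_⟩
  filter_upwards [hon] with y hy
  exact (sum_inner_smul_of_orthonormal hy _).symm

/-- A connection is smooth if it maps smooth sections to smooth sections. -/
def IsSmoothConnection {F : Type*} [NormedAddCommGroup F] [NormedSpace ℝ F]
    {W : M → Type*} [TopologicalSpace (TotalSpace F W)]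
    [∀ x, AddCommGroup (W x)] [∀ x, Module ℝ (W x)] [∀ x : M, TopologicalSpace (W x)]
    [∀ x, IsTopologicalAddGroup (W x)] [∀ x, ContinuousSMul ℝ (W x)]
    [FiberBundle F W] [VectorBundle ℝ F W] (D : CovariantDerivative I F W) : Prop :=
  ∀ s : Π x : M, W x, IsSmoothSection I F s → IsSmoothSection I (E →L[ℝ] F) (D s)

/-- Every term of the Koszul formula is smooth for smooth fields, and a vector field is determined
smoothly by its products with smooth fields. -/
theorem isSmoothConnection_leviCivita [T2Space M] : IsSmoothConnection (leviCivita I M) := by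
  intro Y hY
  refine IsSmoothSection.of_apply fun X hX ↦ IsSmoothSection.of_inner fun Z hZ ↦ ?_
  have h1 : ∀ y, inner ℝ (Z y) (leviCivita I M Y y (X y)) = koszul Y y X Z := fun y ↦ by
    rw [real_inner_comm]
    exact inner_leviCivitaFun (hX.mdifferentiableAt y) (hY.mdifferentiableAt y)
      (hZ.mdifferentiableAt y)
  simp only [h1, koszul]
  have hYZ := contMDiff_mvfderiv_apply (hY.inner hZ) hX
  have hXZ := contMDiff_mvfderiv_apply (hX.inner hZ) hY
  have hXY := contMDiff_mvfderiv_apply (hX.inner hY) hZ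
  exact contMDiff_const.mul (((((hYZ.add hXZ).sub hXY).add ((hX.mlieBracket hY).inner hZ)).sub
    ((hX.mlieBracket hZ).inner hY)).sub ((hY.mlieBracket hZ).inner hX))

section Hom

variable {F : Type*} [NormedAddCommGroup F] [NormedSpace ℝ F]
    {W : M → Type*} [TopologicalSpace (TotalSpace F W)]
    [∀ x, AddCommGroup (W x)] [∀ x, Module ℝ (W x)] [∀ x : M, TopologicalSpace (W x)]
    [∀ x, IsTopologicalAddGroup (W x)] [∀ x, ContinuousSMul ℝ (W x)]
    [FiberBundle F W] [VectorBundle ℝ F W]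
    {cov : CovariantDerivative I E (TangentSpace I : M → Type _)} {D : CovariantDerivative I F W}

theorem homCov_apply {σ : Π x : M, TangentSpace I x →L[ℝ] W x}
    (hσ : IsSmoothSection I (E →L[ℝ] F) σ) {Y : Π x : M, TangentSpace I x}
    (hY : IsSmoothSection I E Y) (x : M) (v : TangentSpace I x) :
    homCov cov D σ x v (Y x) = D (fun y ↦ σ y (Y y)) x v - σ x (cov Y x v) := by
  have := homFun_apply (cov := cov) (D := D) (hσ.mdifferentiableAt x)
    (FiberBundle.mdifferentiableAt_extend I E v) (hY.mdifferentiableAt x)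
  rw [FiberBundle.extend_apply_self] at this
  exact this

theorem isSmoothConnection_homCov [T2Space M] [ContMDiffVectorBundle ∞ F W I]
    (hcov : IsSmoothConnection cov) (hD : IsSmoothConnection D) :
    IsSmoothConnection (homCov cov D) := by
  intro σ hσ
  refine IsSmoothSection.of_apply fun X hX ↦ IsSmoothSection.of_apply fun Y hY ↦ ?_
  simp only [homCov_apply hσ hY]
  exact ((hD _ (hσ.apply hY)).apply hX).sub (hσ.apply ((hcov Y hY).apply hX))

end Hom

end SmoothRiemannian

/-- Both arguments are expanded in the second basis; Parseval for the first basis collapses the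
coefficients to δ_{jk}. -/
theorem sum_orthonormalBasis_eq {V W ι ι' : Type*} [NormedAddCommGroup V] [InnerProductSpace ℝ V]
    [AddCommGroup W] [Module ℝ W] [Fintype ι] [Fintype ι'] (b : OrthonormalBasis ι ℝ V)
    (b' : OrthonormalBasis ι' ℝ V) (f : V →ₗ[ℝ] V →ₗ[ℝ] W) :
    ∑ i, f (b i) (b i) = ∑ j, f (b' j) (b' j) := by
  classical
  have h1 : ∀ i, f (b i) (b i) =
      ∑ j, ∑ k, (inner ℝ (b' j) (b i) * inner ℝ (b i) (b' k)) • f (b' j) (b' k) := by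
    intro i
    conv_lhs => rw [← b'.sum_repr' (b i)]
    simp only [map_sum, map_smul, LinearMap.sum_apply, LinearMap.smul_apply, Finset.smul_sum,
      smul_smul, real_inner_comm (b i)]
    rw [Finset.sum_comm]
    simp only [mul_comm]
  simp only [h1]
  rw [Finset.sum_comm]
  refine Finset.sum_congr rfl fun j _ ↦ ?_
  rw [Finset.sum_comm]
  simp only [← Finset.sum_smul, b.sum_inner_mul_inner, orthonormal_iff_ite.1 b'.orthonormal]
  simp

/-! ### Metric traces, second covariant derivatives and curvature of type (1,1). -/

section Trace
variable {E : Type*} [NormedAddCommGroup E] [NormedSpace ℝ E] [FiniteDimensional ℝ E]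
  [CompleteSpace E]
  {H : Type*} [TopologicalSpace H] {I : ModelWithCorners ℝ E H}
  {M : Type*} [TopologicalSpace M] [ChartedSpace H M] [IsManifold I ∞ M] [T2Space M]
  [RiemannianBundle (fun x : M ↦ TangentSpace I x)]
  [IsContMDiffRiemannianBundle I ∞ E (fun x : M ↦ TangentSpace I x)]
  {F : Type*} [NormedAddCommGroup F] [NormedSpace ℝ F]
  {W : M → Type*} [TopologicalSpace (TotalSpace F W)]
  [∀ x, AddCommGroup (W x)] [∀ x, Module ℝ (W x)] [∀ x : M, TopologicalSpace (W x)]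
  [∀ x, IsTopologicalAddGroup (W x)] [∀ x, ContinuousSMul ℝ (W x)]
  [FiberBundle F W] [VectorBundle ℝ F W] [ContMDiffVectorBundle ∞ F W I]
  {D : CovariantDerivative I F W}

theorem covariantDerivative_add {s t : Π x : M, W x} (hs : IsSmoothSection I F s)
    (ht : IsSmoothSection I F t) (x : M) : D (fun y ↦ s y + t y) x = D s x + D t x :=
  D.isCovariantDerivativeOnUniv.add (hs.mdifferentiableAt x) (ht.mdifferentiableAt x)

theorem covariantDerivative_const_smul {s : Π x : M, W x} (c : ℝ) (hs : IsSmoothSection I F s)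
    (x : M) : D (fun y ↦ c • s y) x = c • D s x :=
  D.isCovariantDerivativeOnUniv.smul_const c (hs.mdifferentiableAt x)

theorem covariantDerivative_neg {s : Π x : M, W x} (hs : IsSmoothSection I F s)
    (x : M) : D (fun y ↦ -s y) x = -D s x := by
  simpa using covariantDerivative_const_smul (D := D) (-1) hs x

theorem covariantDerivative_sub {s t : Π x : M, W x} (hs : IsSmoothSection I F s)
    (ht : IsSmoothSection I F t) (x : M) : D (fun y ↦ s y - t y) x = D s x - D t x := by
  simp only [sub_eq_add_neg, covariantDerivative_add hs ht.neg, covariantDerivative_neg ht]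

theorem covariantDerivative_sum {ι : Type*} (t : Finset ι) {s : ι → Π x : M, W x}
    (hs : ∀ i, IsSmoothSection I F (s i)) (x : M) :
    D (fun y ↦ ∑ i ∈ t, s i y) x = ∑ i ∈ t, D (s i) x := by
  classical
  induction t using Finset.induction_on with
  | empty => exact D.isCovariantDerivativeOnUniv.zero
  | insert a t ha ih =>
    simp only [Finset.sum_insert ha, ← ih]
    exact covariantDerivative_add (hs a) (IsSmoothSection.sum fun i _ ↦ hs i) x

theorem covariantDerivative_congr {s t : Π x : M, W x} (hs : IsSmoothSection I F s)
    (ht : IsSmoothSection I F t) {x : M} (h : ∀ᶠ y in 𝓝 x, s y = t y) : D s x = D t x :=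
  D.isCovariantDerivativeOnUniv.congr_of_eventuallyEq (hs.mdifferentiableAt x)
    (ht.mdifferentiableAt x) univ_mem h

theorem exists_vectorField (x : M) (v : TangentSpace I x) :
    ∃ X : Π x : M, TangentSpace I x, IsSmoothSection I E X ∧ X x = v :=
  exists_isSmoothSection_apply_eq (I := I) (F := E) (W := fun x : M ↦ TangentSpace I x) x v

theorem mvfderiv_inner {Y Z : Π x : M, TangentSpace I x} (hY : IsSmoothSection I E Y)
    (hZ : IsSmoothSection I E Z) (x : M) (v : TangentSpace I x) :
    d% (fun y ↦ (inner ℝ (Y y) (Z y) : ℝ)) x v =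
      inner ℝ (leviCivita I M Y x v) (Z x) + inner ℝ (Y x) (leviCivita I M Z x v) := by
  obtain ⟨X, hX, rfl⟩ := exists_vectorField x v
  exact CovariantDerivative.IsMetricCompatible.mvfderiv_inner_eq
    (V := fun x : M ↦ TangentSpace I x) leviCivita_isMetricCompatible X
    (hY.mdifferentiableAt x) (hZ.mdifferentiableAt x)

/-- The metric trace `∑ᵢ B(eᵢ, eᵢ)`. -/
def metricTrace {x : M} (B : TangentSpace I x →L[ℝ] TangentSpace I x →L[ℝ] W x) : W x :=
  ∑ i, B (stdOrthonormalBasis ℝ (TangentSpace I x) i) (stdOrthonormalBasis ℝ (TangentSpace I x) i)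

theorem metricTrace_eq {ι : Type*} [Fintype ι] {x : M}
    (B : TangentSpace I x →L[ℝ] TangentSpace I x →L[ℝ] W x)
    (b : OrthonormalBasis ι ℝ (TangentSpace I x)) : metricTrace B = ∑ i, B (b i) (b i) :=
  sum_orthonormalBasis_eq _ b (LinearMap.mk₂ ℝ (fun u v ↦ B u v) (by simp) (by simp) (by simp)
    (by simp))

theorem metricTrace_eq_of_orthonormal {x : M}
    (B : TangentSpace I x →L[ℝ] TangentSpace I x →L[ℝ] W x)
    {e : Fin (Module.finrank ℝ E) → TangentSpace I x}
    (he : Orthonormal ℝ e) : metricTrace B = ∑ i, B (e i) (e i) := by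
  have h1 : ⊤ ≤ Submodule.span ℝ (Set.range e) :=
    (he.linearIndependent.span_eq_top_of_card_eq_finrank' (by
      rw [Fintype.card_fin]; rfl)).ge
  simpa using metricTrace_eq B (OrthonormalBasis.mk he h1)

theorem IsSmoothSection.metricTrace {τ : Π x : M, TangentSpace I x →L[ℝ] TangentSpace I x →L[ℝ] W x}
    (hτ : IsSmoothSection I (E →L[ℝ] E →L[ℝ] F) τ) :
    IsSmoothSection I F (fun x ↦ metricTrace (τ x)) := by
  refine IsSmoothSection.of_locally fun x ↦ ?_
  obtain ⟨e, he, hon⟩ := exists_orthonormal_frame (I := I) x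
  refine ⟨fun y ↦ ∑ i, τ y (e i y) (e i y),
    IsSmoothSection.sum fun i _ ↦ (hτ.apply (he i)).apply (he i), ?_⟩
  filter_upwards [hon] with y hy
  exact metricTrace_eq_of_orthonormal (τ y) hy

/-- The metric trace commutes with covariant derivatives. -/
theorem covariantDerivative_metricTrace
    {τ : Π x : M, TangentSpace I x →L[ℝ] TangentSpace I x →L[ℝ] W x}
    (hτ : IsSmoothSection I (E →L[ℝ] E →L[ℝ] F) τ) (x : M) (v : TangentSpace I x) :
    D (fun y ↦ metricTrace (τ y)) x v =
      metricTrace (homCov (leviCivita I M) (homCov (leviCivita I M) D) τ x v) := by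
  obtain ⟨e, he, hon⟩ := exists_orthonormal_frame (I := I) x
  have hex := hon.self_of_nhds
  have h1 : D (fun y ↦ metricTrace (τ y)) x = D (fun y ↦ ∑ i, τ y (e i y) (e i y)) x :=
    covariantDerivative_congr hτ.metricTrace
      (IsSmoothSection.sum fun i _ ↦ (hτ.apply (he i)).apply (he i))
      (hon.mono fun y hy ↦ metricTrace_eq_of_orthonormal (τ y) hy)
  have h2 : ∀ i, D (fun y ↦ τ y (e i y) (e i y)) x v =
      homCov (leviCivita I M) (homCov (leviCivita I M) D) τ x v (e i x) (e i x) +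
        (τ x (leviCivita I M (e i) x v) (e i x) + τ x (e i x) (leviCivita I M (e i) x v)) := by
    intro i
    have ha := homCov_apply (cov := leviCivita I M) (D := D) (hτ.apply (he i)) (he i) x v
    have hb := homCov_apply (cov := leviCivita I M) (D := homCov (leviCivita I M) D) hτ (he i) x v
    rw [hb]
    simp only [sub_apply]
    rw [ha]
    abel
  -- The connection coefficients of an orthonormal frame are skew, because the functions g(e_i, e_j)
  -- are constant near x.
  have h3 : ∀ i j, inner ℝ (e j x) (leviCivita I M (e i) x v) =
      -inner ℝ (e i x) (leviCivita I M (e j) x v) := by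
    intro i j
    have ha := mvfderiv_inner (he i) (he j) x v
    have hb : d% (fun y ↦ (inner ℝ (e i y) (e j y) : ℝ)) x = 0 := by
      have : (fun y ↦ (inner ℝ (e i y) (e j y) : ℝ)) =ᶠ[𝓝 x]
          fun _ ↦ (inner ℝ (e i x) (e j x) : ℝ) := by
        filter_upwards [hon] with y hy
        rw [orthonormal_iff_ite.1 hy, orthonormal_iff_ite.1 hex]
      rw [mvfderiv, this.mfderiv_eq]
      simp [mfderiv_const]
    rw [hb, real_inner_comm] at ha
    simp at ha
    linarith
  -- The derivatives of the frame contribute a sum of skew coefficients against the symmetrization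
  -- of τ, which is zero.
  have h4 : ∑ i, (τ x (leviCivita I M (e i) x v) (e i x) +
      τ x (e i x) (leviCivita I M (e i) x v)) = 0 := by
    have h5 : ∀ i, leviCivita I M (e i) x v =
        ∑ j, inner ℝ (e j x) (leviCivita I M (e i) x v) • e j x :=
      fun i ↦ (sum_inner_smul_of_orthonormal hex _).symm
    have h6 : ∀ i, τ x (leviCivita I M (e i) x v) (e i x) =
        ∑ j, inner ℝ (e j x) (leviCivita I M (e i) x v) • τ x (e j x) (e i x) := by
      intro i
      conv_lhs => rw [h5 i]
      simp
    have h7 : ∀ i, τ x (e i x) (leviCivita I M (e i) x v) =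
        ∑ j, inner ℝ (e j x) (leviCivita I M (e i) x v) • τ x (e i x) (e j x) := by
      intro i
      conv_lhs => rw [h5 i]
      simp
    simp only [h6, h7, Finset.sum_add_distrib]
    rw [Finset.sum_comm, ← Finset.sum_add_distrib]
    refine Finset.sum_eq_zero fun i _ ↦ ?_
    rw [← Finset.sum_add_distrib]
    refine Finset.sum_eq_zero fun j _ ↦ ?_
    rw [h3 i j]
    simp
  rw [h1, covariantDerivative_sum _ (fun i ↦ (hτ.apply (he i)).apply (he i)),
    sum_apply, metricTrace_eq_of_orthonormal _ hex]
  simp only [h2, Finset.sum_add_distrib]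
  rw [← Finset.sum_add_distrib (f := fun i ↦ τ x (leviCivita I M (e i) x v) (e i x)), h4, add_zero]

variable (D) in
/-- The second covariant derivative `secondDeriv D s x u v = ∇²_{u,v} s`. -/
def secondDeriv (s : Π x : M, W x) (x : M) : TangentSpace I x →L[ℝ] TangentSpace I x →L[ℝ] W x :=
  homCov (leviCivita I M) D (D s) x

theorem secondDeriv_apply (hD : IsSmoothConnection D) {s : Π x : M, W x}
    (hs : IsSmoothSection I F s) {Y : Π x : M, TangentSpace I x} (hY : IsSmoothSection I E Y)
    (x : M) (u : TangentSpace I x) :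
    secondDeriv D s x u (Y x) = D (fun y ↦ D s y (Y y)) x u - D s x (leviCivita I M Y x u) :=
  homCov_apply (hD s hs) hY x u

theorem secondDeriv_eq_zero_of_parallel (hD : IsSmoothConnection D) {s : Π x : M, W x}
    (hs : IsSmoothSection I F s) (h : ∀ x, D s x = 0) (x : M) : secondDeriv D s x = 0 := by
  ext u v
  obtain ⟨Y, hY, rfl⟩ := exists_vectorField x v
  rw [secondDeriv_apply hD hs hY]
  simp only [h, zero_apply, sub_zero]
  exact congrArg (fun A ↦ A u) (D.isCovariantDerivativeOnUniv.zero (x := x))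

/-- Second covariant derivative of the contraction of a section of `Hom(TM, W)` with a vector
field. -/
theorem secondDeriv_clm_apply (hD : IsSmoothConnection D)
    {σ : Π x : M, TangentSpace I x →L[ℝ] W x} (hσ : IsSmoothSection I (E →L[ℝ] F) σ)
    {Z : Π x : M, TangentSpace I x} (hZ : IsSmoothSection I E Z) (x : M) (u v : TangentSpace I x) :
    secondDeriv D (fun y ↦ σ y (Z y)) x u v =
      secondDeriv (homCov (leviCivita I M) D) σ x u v (Z x) +
        (homCov (leviCivita I M) D σ x v (leviCivita I M Z x u) +
          homCov (leviCivita I M) D σ x u (leviCivita I M Z x v)) +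
        σ x (secondDeriv (leviCivita I M) Z x u v) := by
  obtain ⟨Y, hY, rfl⟩ := exists_vectorField x v
  have hlc := isSmoothConnection_leviCivita (I := I) (M := M)
  have hn := isSmoothConnection_homCov hlc hD
  have hnσ := hn σ hσ
  rw [secondDeriv_apply hD (hσ.apply hZ) hY, secondDeriv_apply hn hσ hY,
    secondDeriv_apply hlc hZ hY]
  have h1 : ∀ y w, D (fun y ↦ σ y (Z y)) y w =
      homCov (leviCivita I M) D σ y w (Z y) + σ y (leviCivita I M Z y w) := by
    intro y w
    rw [homCov_apply hσ hZ]
    abel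
  simp only [h1]
  have h2 := homCov_apply (cov := leviCivita I M) (D := D) (hnσ.apply hY) hZ x u
  have h3 := homCov_apply (cov := leviCivita I M) (D := D) hσ ((hlc Z hZ).apply hY) x u
  rw [covariantDerivative_add ((hnσ.apply hY).apply hZ) (hσ.apply ((hlc Z hZ).apply hY))]
  simp only [add_apply, sub_apply, map_sub]
  rw [h2, h3]
  abel

variable (D) in
/-- The curvature of the connection `D` is of type `(1,1)` with respect to `J`. -/
def IsTypeOneOne (J : EndField I M) : Prop :=
  ∀ s : Π x : M, W x, IsSmoothSection I F s → ∀ (x : M) (u v : TangentSpace I x),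
    secondDeriv D s x (J x u) (J x v) - secondDeriv D s x (J x v) (J x u) =
      secondDeriv D s x u v - secondDeriv D s x v u

/-- The curvature of Hom(TM, W) acts by (Rσ)Z = R(σZ) - σ(RZ): the mixed first-order terms of
`secondDeriv_clm_apply` are symmetric in u, v and drop out. Type (1,1) therefore passes to all
iterated Hom bundles. -/
theorem isTypeOneOne_homCov {J : EndField I M} (hD : IsSmoothConnection D)
    (hlJ : IsTypeOneOne (leviCivita I M) J) (hDJ : IsTypeOneOne D J) :
    IsTypeOneOne (homCov (leviCivita I M) D) J := by
  intro σ hσ x u v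
  ext z
  obtain ⟨Z, hZ, rfl⟩ := exists_vectorField x z
  have h1 := hDJ _ (hσ.apply hZ) x u v
  have h2 := congrArg (σ x) (hlJ _ hZ x u v)
  simp only [secondDeriv_clm_apply hD hσ hZ] at h1
  simp only [map_sub] at h2
  simp only [sub_apply]
  linear_combination (norm := module) h1 - h2

end Trace

/-! ### Symmetries of the Riemann tensor; Kähler curvature is of type (1,1). -/

section Curvature
variable {E : Type*} [NormedAddCommGroup E] [NormedSpace ℝ E] [FiniteDimensional ℝ E]
  [CompleteSpace E]
  {H : Type*} [TopologicalSpace H] {I : ModelWithCorners ℝ E H}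
  {M : Type*} [TopologicalSpace M] [ChartedSpace H M] [IsManifold I ∞ M] [T2Space M]
  [RiemannianBundle (fun x : M ↦ TangentSpace I x)]
  [IsContMDiffRiemannianBundle I ∞ E (fun x : M ↦ TangentSpace I x)]

open VectorField

theorem leibniz_mlieBracket {X Y Z : Π x : M, TangentSpace I x} (hX : IsSmoothSection I E X)
    (hY : IsSmoothSection I E Y) (hZ : IsSmoothSection I E Z) (x : M) :
    mlieBracket I X (mlieBracket I Y Z) x =
      mlieBracket I (mlieBracket I X Y) Z x + mlieBracket I Y (mlieBracket I X Z) x := by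
  have : IsManifold I (minSmoothness ℝ 3) M := by
    rw [minSmoothness_of_isRCLikeNormedField]; infer_instance
  have hle : minSmoothness ℝ 2 ≤ ∞ := by
    rw [minSmoothness_of_isRCLikeNormedField]; exact WithTop.coe_le_coe.2 le_top
  exact leibniz_identity_mlieBracket_apply ((hX x).of_le hle) ((hY x).of_le hle)
    ((hZ x).of_le hle)

/-- Read off from the Jacobi identity for X, Y and fZ: by the Leibniz rule its f-derivative terms
reduce to the difference of the two sides times Z, and Z is chosen with Z(x) ≠ 0. -/
theorem mvfderiv_mlieBracket {f : M → ℝ} (hf : ContMDiff I 𝓘(ℝ) ∞ f)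
    {X Y : Π x : M, TangentSpace I x} (hX : IsSmoothSection I E X)
    (hY : IsSmoothSection I E Y) (x : M) :
    d% (fun y ↦ d% f y (Y y)) x (X x) - d% (fun y ↦ d% f y (X y)) x (Y x) =
      d% f x (mlieBracket I X Y x) := by
  -- A zero tangent space admits no such Z, but then both sides vanish.
  by_cases h0 : ∀ v : TangentSpace I x, v = 0
  · simp [h0 (X x), h0 (Y x), h0 (mlieBracket I X Y x)]
  push Not at h0
  obtain ⟨v, hv⟩ := h0
  obtain ⟨Z, hZ, rfl⟩ := exists_vectorField x v
  have hfd : ∀ y, MDiffAt f y := fun y ↦ (hf y).mdifferentiableAt (by simp)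
  have key : ∀ {U V : Π x : M, TangentSpace I x}, IsSmoothSection I E U → IsSmoothSection I E V →
      mlieBracket I U (mlieBracket I V (f • Z)) x =
        d% (fun y ↦ d% f y (V y)) x (U x) • Z x + d% f x (V x) • mlieBracket I U Z x +
          (d% f x (U x) • mlieBracket I V Z x + f x • mlieBracket I U (mlieBracket I V Z) x) := by
    intro U V hU hV
    have h1 : mlieBracket I V (f • Z) =
        (fun y ↦ d% f y (V y)) • Z + f • mlieBracket I V Z := by
      ext1 y
      exact mlieBracket_smul_right (hfd y) (hZ.mdifferentiableAt y)
    have hdf := contMDiff_mvfderiv_apply hf hV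
    have h2 := hV.mlieBracket hZ
    have h3 := mlieBracket_add_right (V := U) ((IsSmoothSection.smul hdf hZ).mdifferentiableAt x)
      ((IsSmoothSection.smul hf h2).mdifferentiableAt x)
    rw [h1]
    refine h3.trans ?_
    change mlieBracket I U ((fun y ↦ d% f y (V y)) • Z) x +
      mlieBracket I U (f • mlieBracket I V Z) x = _
    rw [mlieBracket_smul_right ((hdf x).mdifferentiableAt (by simp)) (hZ.mdifferentiableAt x),
      mlieBracket_smul_right (hfd x) (h2.mdifferentiableAt x)]
  have hL := leibniz_mlieBracket hX hY (IsSmoothSection.smul hf hZ) x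
  change mlieBracket I X (mlieBracket I Y (f • Z)) x = mlieBracket I (mlieBracket I X Y) (f • Z) x +
    mlieBracket I Y (mlieBracket I X (f • Z)) x at hL
  rw [key hX hY, key hY hX, mlieBracket_smul_right (hfd x) (hZ.mdifferentiableAt x),
    leibniz_mlieBracket hX hY hZ x] at hL
  have h3 : (d% (fun y ↦ d% f y (Y y)) x (X x) - d% (fun y ↦ d% f y (X y)) x (Y x) -
      d% f x (mlieBracket I X Y x)) • Z x = 0 := by
    linear_combination (norm := module) hL
  exact sub_eq_zero.1 ((smul_eq_zero.1 h3).resolve_right hv)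

theorem leviCivita_sub_swap {X Y : Π x : M, TangentSpace I x} (hX : IsSmoothSection I E X)
    (hY : IsSmoothSection I E Y) (x : M) :
    leviCivita I M Y x (X x) - leviCivita I M X x (Y x) = mlieBracket I X Y x :=
  (CovariantDerivative.torsion_eq_zero_iff _).1 leviCivita_torsion (hX.mdifferentiableAt x)
    (hY.mdifferentiableAt x)

/-- The value `g(R(X,Y)Z, W)` of the curvature tensor at `x`. -/
def riemann (x : M) (X Y Z W : Π x : M, TangentSpace I x) : ℝ :=
  inner ℝ (secondDeriv (leviCivita I M) Z x (X x) (Y x) -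
    secondDeriv (leviCivita I M) Z x (Y x) (X x)) (W x)

theorem riemann_swap_left (x : M) (X Y Z W : Π x : M, TangentSpace I x) :
    riemann x X Y Z W = -riemann x Y X Z W := by
  rw [riemann, riemann, ← inner_neg_left, neg_sub]

/-- Metric compatibility: differentiate the function g(Z, W) twice and compare XY - YX with [X,Y].
The mixed first-order products are symmetric in X, Y and cancel. -/
theorem riemann_swap_right {X Y Z W : Π x : M, TangentSpace I x} (hX : IsSmoothSection I E X)
    (hY : IsSmoothSection I E Y) (hZ : IsSmoothSection I E Z) (hW : IsSmoothSection I E W)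
    (x : M) : riemann x X Y Z W = -riemann x X Y W Z := by
  have hlc := isSmoothConnection_leviCivita (I := I) (M := M)
  have key : ∀ {U V : Π x : M, TangentSpace I x}, IsSmoothSection I E U → IsSmoothSection I E V →
      d% (fun y ↦ d% (fun y ↦ (inner ℝ (Z y) (W y) : ℝ)) y (V y)) x (U x) =
        inner ℝ (leviCivita I M (fun y ↦ leviCivita I M Z y (V y)) x (U x)) (W x) +
        inner ℝ (leviCivita I M Z x (V x)) (leviCivita I M W x (U x)) +
        (inner ℝ (leviCivita I M Z x (U x)) (leviCivita I M W x (V x)) +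
        inner ℝ (Z x) (leviCivita I M (fun y ↦ leviCivita I M W y (V y)) x (U x))) := by
    intro U V hU hV
    have hZV := (hlc Z hZ).apply hV
    have hWV := (hlc W hW).apply hV
    simp only [mvfderiv_inner hZ hW]
    rw [mvfderiv_fun_add (((hZV.inner hW) x).mdifferentiableAt (by simp))
      (((hZ.inner hWV) x).mdifferentiableAt (by simp)), add_apply, mvfderiv_inner hZV hW,
      mvfderiv_inner hZ hWV]
  have h1 := mvfderiv_mlieBracket (hZ.inner hW) hX hY x
  rw [key hX hY, key hY hX, ← leviCivita_sub_swap hX hY, mvfderiv_inner hZ hW, map_sub, map_sub,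
    inner_sub_left, inner_sub_right] at h1
  rw [riemann, riemann, secondDeriv_apply hlc hZ hY, secondDeriv_apply hlc hZ hX,
    secondDeriv_apply hlc hW hY, secondDeriv_apply hlc hW hX]
  simp only [inner_sub_left]
  simp only [real_inner_comm (Z x)] at h1 ⊢
  linarith

/-- Vanishing torsion rewrites the Jacobi identity for Lie brackets as the cyclic sum of second
covariant derivatives. -/
theorem riemann_bianchi {X Y Z W : Π x : M, TangentSpace I x} (hX : IsSmoothSection I E X)
    (hY : IsSmoothSection I E Y) (hZ : IsSmoothSection I E Z) (x : M) :
    riemann x X Y Z W + riemann x Y Z X W + riemann x Z X Y W = 0 := by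
  have hlc := isSmoothConnection_leviCivita (I := I) (M := M)
  have key : ∀ {U V S : Π x : M, TangentSpace I x}, IsSmoothSection I E U →
      IsSmoothSection I E V → IsSmoothSection I E S →
      leviCivita I M (fun y ↦ leviCivita I M S y (V y)) x (U x) -
        leviCivita I M (fun y ↦ leviCivita I M V y (S y)) x (U x) -
        leviCivita I M U x (leviCivita I M S x (V x)) +
        leviCivita I M U x (leviCivita I M V x (S x)) =
      mlieBracket I U (mlieBracket I V S) x := by
    intro U V S hU hV hS
    rw [← leviCivita_sub_swap hU (hV.mlieBracket hS)]
    have h1 : mlieBracket I V S = fun y ↦ leviCivita I M S y (V y) - leviCivita I M V y (S y) := by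
      ext1 y
      exact (leviCivita_sub_swap hV hS y).symm
    rw [h1, covariantDerivative_sub ((hlc S hS).apply hV) ((hlc V hV).apply hS), sub_apply, map_sub]
    abel
  have hJ := leibniz_mlieBracket hX hY hZ x
  rw [mlieBracket_swap_apply (V := mlieBracket I X Y)] at hJ
  have hs : mlieBracket I X Z = -mlieBracket I Z X := mlieBracket_swap
  have hYs : mlieBracket I Y (mlieBracket I X Z) x = -mlieBracket I Y (mlieBracket I Z X) x := by
    have h2 := mlieBracket_const_smul_right (V := Y) (c := (-1 : ℝ))
      ((hZ.mlieBracket hX).mdifferentiableAt x)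
    rw [hs]
    simpa using h2
  rw [hYs, ← key hX hY hZ, ← key hY hZ hX, ← key hZ hX hY] at hJ
  simp only [riemann, ← inner_add_left, secondDeriv_apply hlc hZ hY, secondDeriv_apply hlc hZ hX,
    secondDeriv_apply hlc hX hY, secondDeriv_apply hlc hX hZ, secondDeriv_apply hlc hY hX,
    secondDeriv_apply hlc hY hZ]
  rw [← inner_zero_left (𝕜 := ℝ) (W x)]
  congr 1
  linear_combination (norm := module) hJ

/-- The classical octahedron argument: a linear combination of four Bianchi identities and the two
skew symmetries. -/
theorem riemann_pair_symm {X Y Z W : Π x : M, TangentSpace I x} (hX : IsSmoothSection I E X)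
    (hY : IsSmoothSection I E Y) (hZ : IsSmoothSection I E Z) (hW : IsSmoothSection I E W)
    (x : M) : riemann x X Y Z W = riemann x Z W X Y := by
  have b1 := riemann_bianchi (W := W) hX hY hZ x
  have b2 := riemann_bianchi (W := X) hY hZ hW x
  have b3 := riemann_bianchi (W := Y) hZ hW hX x
  have b4 := riemann_bianchi (W := Z) hW hX hY x
  have s1 := riemann_swap_right hX hY hZ hW x
  have s2 := riemann_swap_right hY hZ hX hW x
  have s3 := riemann_swap_right hZ hX hY hW x
  have s4 := riemann_swap_right hZ hW hX hY x
  have s5 := riemann_swap_right hW hY hZ hX x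
  have s6 := riemann_swap_right hW hX hZ hY x
  have t1 := riemann_swap_left x X W Y Z
  have t2 := riemann_swap_left x W Y X Z
  have t3 := riemann_swap_left x Z X W Y
  linarith

variable {J : EndField I M}

theorem IsKaehler.secondDeriv_apply (hJ : IsKaehler J) {X : Π x : M, TangentSpace I x}
    (hX : IsSmoothSection I E X) (x : M) (u v : TangentSpace I x) :
    secondDeriv (leviCivita I M) (fun y ↦ J y (X y)) x u v =
      J x (secondDeriv (leviCivita I M) X x u v) := by
  have hlc := isSmoothConnection_leviCivita (I := I) (M := M)
  have h0 : ∀ y, homCov (leviCivita I M) (leviCivita I M) J y = 0 := hJ.parallel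
  rw [secondDeriv_clm_apply hlc hJ.smooth hX, secondDeriv_eq_zero_of_parallel
    (isSmoothConnection_homCov hlc hlc) hJ.smooth h0, h0]
  simp

theorem IsKaehler.inner_apply_left (hJ : IsKaehler J) (x : M) (u v : TangentSpace I x) :
    inner ℝ (J x u) v = -inner ℝ u (J x v) := by
  rw [← hJ.isometry x u (J x v), hJ.sq, inner_neg_right, neg_neg]

/-- The curvature of a Kähler metric is of type `(1,1)`. -/
theorem IsKaehler.isTypeOneOne (hJ : IsKaehler J) : IsTypeOneOne (leviCivita I M) J := by
  intro Z hZ x u v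
  obtain ⟨X, hX, rfl⟩ := exists_vectorField x u
  obtain ⟨Y, hY, rfl⟩ := exists_vectorField x v
  refine ext_inner_right ℝ fun w ↦ ?_
  obtain ⟨W, hW, rfl⟩ := exists_vectorField x w
  have hJs : IsSmoothSection I (E →L[ℝ] E) J := hJ.smooth
  -- Pair symmetry moves JX, JY from the form slots to the endomorphism slots, where the parallel
  -- isometry J can be removed.
  have h1 := riemann_pair_symm (hJs.apply hX) (hJs.apply hY) hZ hW x
  have h2 := riemann_pair_symm hX hY hZ hW x
  have h3 : riemann x Z W (fun y ↦ J y (X y)) (fun y ↦ J y (Y y)) = riemann x Z W X Y := by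
    rw [riemann, hJ.secondDeriv_apply hX, hJ.secondDeriv_apply hX, ← map_sub, hJ.isometry, riemann]
  exact h1.trans (h3.trans h2.symm)

end Curvature

/-! ### Parallel symmetries and commuting derivatives in double divergences. -/

section Divergence
variable {E : Type*} [NormedAddCommGroup E] [NormedSpace ℝ E] [FiniteDimensional ℝ E]
  [CompleteSpace E]
  {H : Type*} [TopologicalSpace H] {I : ModelWithCorners ℝ E H}
  {M : Type*} [TopologicalSpace M] [ChartedSpace H M] [IsManifold I ∞ M] [T2Space M]
  [RiemannianBundle (fun x : M ↦ TangentSpace I x)]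
  [IsContMDiffRiemannianBundle I ∞ E (fun x : M ↦ TangentSpace I x)]
  {F : Type*} [NormedAddCommGroup F] [NormedSpace ℝ F]
  {W : M → Type*} [TopologicalSpace (TotalSpace F W)]
  [∀ x, AddCommGroup (W x)] [∀ x, Module ℝ (W x)] [∀ x : M, TopologicalSpace (W x)]
  [∀ x, IsTopologicalAddGroup (W x)] [∀ x, ContinuousSMul ℝ (W x)]
  [FiberBundle F W] [VectorBundle ℝ F W] [ContMDiffVectorBundle ∞ F W I]
  {D : CovariantDerivative I F W} {J : EndField I M}

variable (D) in
/-- The divergence `-∑ᵢ (∇_{eᵢ} σ)(eᵢ)` of a section of `Hom(TM, W)`. -/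
def divHom (σ : Π x : M, TangentSpace I x →L[ℝ] W x) (x : M) : W x :=
  -metricTrace (homCov (leviCivita I M) D σ x)

theorem IsSmoothSection.divHom (hD : IsSmoothConnection D)
    {σ : Π x : M, TangentSpace I x →L[ℝ] W x} (hσ : IsSmoothSection I (E →L[ℝ] F) σ) :
    IsSmoothSection I F (divHom D σ) :=
  (isSmoothConnection_homCov isSmoothConnection_leviCivita hD σ hσ).metricTrace.neg

theorem covariantDerivative_divHom (hD : IsSmoothConnection D)
    {σ : Π x : M, TangentSpace I x →L[ℝ] W x} (hσ : IsSmoothSection I (E →L[ℝ] F) σ) (x : M)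
    (v : TangentSpace I x) :
    D (divHom D σ) x v = -metricTrace (secondDeriv (homCov (leviCivita I M) D) σ x v) := by
  have h1 := isSmoothConnection_homCov isSmoothConnection_leviCivita hD σ hσ
  have h2 := covariantDerivative_neg (D := D) h1.metricTrace x
  have h3 := covariantDerivative_metricTrace (D := D) h1 x v
  change D (fun y ↦ -metricTrace (homCov (leviCivita I M) D σ y)) x v = _
  rw [h2, neg_apply, h3]
  rfl

theorem divHom_const_smul
    {σ : Π x : M, TangentSpace I x →L[ℝ] W x} (hσ : IsSmoothSection I (E →L[ℝ] F) σ) (c : ℝ)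
    (x : M) : divHom D (fun y ↦ c • σ y) x = c • divHom D σ x := by
  have h := covariantDerivative_const_smul (D := homCov (leviCivita I M) D) c hσ x
  rw [divHom, divHom, h]
  simp [metricTrace, Finset.smul_sum]

theorem divHom_divHom (hD : IsSmoothConnection D)
    {τ : Π x : M, TangentSpace I x →L[ℝ] TangentSpace I x →L[ℝ] W x}
    (hτ : IsSmoothSection I (E →L[ℝ] E →L[ℝ] F) τ) (x : M) :
    divHom D (divHom (homCov (leviCivita I M) D) τ) x =
      ∑ j, ∑ i, secondDeriv (homCov (leviCivita I M) (homCov (leviCivita I M) D)) τ x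
        (stdOrthonormalBasis ℝ (TangentSpace I x) j) (stdOrthonormalBasis ℝ (TangentSpace I x) i)
        (stdOrthonormalBasis ℝ (TangentSpace I x) i)
        (stdOrthonormalBasis ℝ (TangentSpace I x) j) := by
  have h1 := isSmoothConnection_homCov isSmoothConnection_leviCivita hD
  rw [divHom, metricTrace, ← Finset.sum_neg_distrib]
  refine Finset.sum_congr rfl fun j _ ↦ ?_
  rw [covariantDerivative_divHom h1 hτ]
  simp [metricTrace]

variable (D) in
/-- The family of subspaces `P` is preserved by the connection `D`. -/
def IsParallel (P : Π x : M, Submodule ℝ (W x)) : Prop :=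
  ∀ s : Π x : M, W x, IsSmoothSection I F s → (∀ x, s x ∈ P x) →
    ∀ (x : M) (v : TangentSpace I x), D s x v ∈ P x

/-- Used to transfer each pointwise symmetry of a tensor to its second covariant derivative. -/
theorem IsParallel.secondDeriv_mem (hD : IsSmoothConnection D) {P : Π x : M, Submodule ℝ (W x)}
    (hP : IsParallel D P) {s : Π x : M, W x} (hs : IsSmoothSection I F s) (hsP : ∀ x, s x ∈ P x)
    (x : M) (u v : TangentSpace I x) : secondDeriv D s x u v ∈ P x := by
  obtain ⟨Y, hY, rfl⟩ := exists_vectorField x v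
  rw [secondDeriv_apply hD hs hY]
  exact sub_mem (hP _ ((hD s hs).apply hY) (fun y ↦ hP s hs hsP y _) x u) (hP s hs hsP x _)

theorem homCov_homCov_apply {τ : Π x : M, TangentSpace I x →L[ℝ] TangentSpace I x →L[ℝ] W x}
    (hτ : IsSmoothSection I (E →L[ℝ] E →L[ℝ] F) τ) {X Y : Π x : M, TangentSpace I x}
    (hX : IsSmoothSection I E X) (hY : IsSmoothSection I E Y) (x : M) (v : TangentSpace I x) :
    homCov (leviCivita I M) (homCov (leviCivita I M) D) τ x v (X x) (Y x) =
      D (fun y ↦ τ y (X y) (Y y)) x v - τ x (leviCivita I M X x v) (Y x) -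
        τ x (X x) (leviCivita I M Y x v) := by
  have h1 := homCov_apply (cov := leviCivita I M) (D := D) (hτ.apply hX) hY x v
  have h2 := homCov_apply (cov := leviCivita I M) (D := homCov (leviCivita I M) D) hτ hX x v
  rw [h2, sub_apply, h1]
  abel

theorem IsKaehler.leviCivita_apply (hJ : IsKaehler J) {X : Π x : M, TangentSpace I x}
    (hX : IsSmoothSection I E X) (x : M) (v : TangentSpace I x) :
    leviCivita I M (fun y ↦ J y (X y)) x v = J x (leviCivita I M X x v) := by
  have h1 := homCov_apply (cov := leviCivita I M) (D := leviCivita I M) hJ.smooth hX x v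
  have h2 : homCov (leviCivita I M) (leviCivita I M) J x = 0 := hJ.parallel x
  rw [h2] at h1
  exact (sub_eq_zero.1 h1.symm)

variable (W) in
/-- The bilinear maps `B : TM × TM → W` with `B(Ju, Jv) = -B(u, v)`. -/
def antiInvariant (J : EndField I M) (x : M) :
    Submodule ℝ (TangentSpace I x →L[ℝ] TangentSpace I x →L[ℝ] W x) where
  carrier := {B | ∀ u v, B (J x u) (J x v) = -B u v}
  add_mem' ha hb u v := by simp [ha u v, hb u v]; abel
  zero_mem' u v := by simp
  smul_mem' c B hB u v := by simp [hB u v]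

theorem isParallel_antiInvariant (hJ : IsKaehler J) :
    IsParallel (homCov (leviCivita I M) (homCov (leviCivita I M) D)) (antiInvariant W J) := by
  intro τ hτ hP x w u v
  obtain ⟨X, hX, rfl⟩ := exists_vectorField x u
  obtain ⟨Y, hY, rfl⟩ := exists_vectorField x v
  have hJs : IsSmoothSection I (E →L[ℝ] E) J := hJ.smooth
  have h1 := homCov_homCov_apply (D := D) hτ (hJs.apply hX) (hJs.apply hY) x w
  have h2 : (fun y ↦ τ y (J y (X y)) (J y (Y y))) = fun y ↦ -τ y (X y) (Y y) :=
    funext fun y ↦ hP y _ _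
  rw [h1, h2, homCov_homCov_apply hτ hX hY, hJ.leviCivita_apply hX, hJ.leviCivita_apply hY,
    hP x, hP x, covariantDerivative_neg ((hτ.apply hX).apply hY), neg_apply]
  abel

variable (W) in
/-- The alternating bilinear maps `TM × TM → W`. -/
def alternating (x : M) :
    Submodule ℝ (TangentSpace I x →L[ℝ] TangentSpace I x →L[ℝ] W x) where
  carrier := {B | ∀ u v, B u v = -B v u}
  add_mem' ha hb u v := by simp only [add_apply, ha u v, hb u v]; abel
  zero_mem' u v := by simp
  smul_mem' c B hB u v := by simp only [smul_apply, hB u v, smul_neg]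

theorem isParallel_alternating :
    IsParallel (homCov (leviCivita I M) (homCov (leviCivita I M) D)) (alternating W) := by
  intro τ hτ hP x w u v
  obtain ⟨X, hX, rfl⟩ := exists_vectorField x u
  obtain ⟨Y, hY, rfl⟩ := exists_vectorField x v
  have h2 : (fun y ↦ τ y (X y) (Y y)) = fun y ↦ -τ y (Y y) (X y) :=
    funext fun y ↦ hP y _ _
  rw [homCov_homCov_apply hτ hX hY, homCov_homCov_apply hτ hY hX, h2,
    covariantDerivative_neg ((hτ.apply hY).apply hX), neg_apply,
    hP x (leviCivita I M X x w), hP x (X x)]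
  abel

/-- J is an isometry, so the vectors J e_i form another orthonormal basis. -/
theorem IsKaehler.sum_orthonormal_eq (hJ : IsKaehler J) {x : M} {V : Type*} [AddCommGroup V]
    [Module ℝ V] (f : TangentSpace I x →ₗ[ℝ] TangentSpace I x →ₗ[ℝ] V) :
    ∑ i, f (stdOrthonormalBasis ℝ (TangentSpace I x) i)
        (stdOrthonormalBasis ℝ (TangentSpace I x) i) =
      ∑ i, f (J x (stdOrthonormalBasis ℝ (TangentSpace I x) i))
        (J x (stdOrthonormalBasis ℝ (TangentSpace I x) i)) := by
  have h1 : Orthonormal ℝ (fun i ↦ J x (stdOrthonormalBasis ℝ (TangentSpace I x) i)) := by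
    rw [orthonormal_iff_ite]
    intro i j
    rw [hJ.isometry]
    exact orthonormal_iff_ite.1 (stdOrthonormalBasis ℝ (TangentSpace I x)).orthonormal i j
  have h2 : ⊤ ≤ Submodule.span ℝ
      (Set.range (fun i ↦ J x (stdOrthonormalBasis ℝ (TangentSpace I x) i))) :=
    (h1.linearIndependent.span_eq_top_of_card_eq_finrank' (by simp)).ge
  simpa using sum_orthonormalBasis_eq (stdOrthonormalBasis ℝ (TangentSpace I x))
    (OrthonormalBasis.mk h1 h2) f

/-- On `J`-anti-invariant sections of `Hom(TM, Hom(TM, W))`, the two covariant derivatives in a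
double divergence commute. -/
theorem IsKaehler.sum_secondDeriv_comm (hJ : IsKaehler J) (hD : IsSmoothConnection D)
    (hDJ : IsTypeOneOne D J) {τ : Π x : M, TangentSpace I x →L[ℝ] TangentSpace I x →L[ℝ] W x}
    (hτ : IsSmoothSection I (E →L[ℝ] E →L[ℝ] F) τ) (hτJ : ∀ x, τ x ∈ antiInvariant W J x) (x : M) :
    (∑ j, ∑ i, secondDeriv (homCov (leviCivita I M) (homCov (leviCivita I M) D)) τ x
        (stdOrthonormalBasis ℝ (TangentSpace I x) j) (stdOrthonormalBasis ℝ (TangentSpace I x) i)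
        (stdOrthonormalBasis ℝ (TangentSpace I x) i)
        (stdOrthonormalBasis ℝ (TangentSpace I x) j)) =
      ∑ j, ∑ i, secondDeriv (homCov (leviCivita I M) (homCov (leviCivita I M) D)) τ x
        (stdOrthonormalBasis ℝ (TangentSpace I x) i) (stdOrthonormalBasis ℝ (TangentSpace I x) j)
        (stdOrthonormalBasis ℝ (TangentSpace I x) i)
        (stdOrthonormalBasis ℝ (TangentSpace I x) j) := by
  have hlc := isSmoothConnection_leviCivita (I := I) (M := M)
  have hD1 := isSmoothConnection_homCov hlc hD
  have hD2 := isSmoothConnection_homCov hlc hD1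
  have hT2 := isTypeOneOne_homCov hD1 hJ.isTypeOneOne
    (isTypeOneOne_homCov hD hJ.isTypeOneOne hDJ)
  let A := secondDeriv (homCov (leviCivita I M) (homCov (leviCivita I M) D)) τ x
  let e := stdOrthonormalBasis ℝ (TangentSpace I x)
  have hA : ∀ u v a b, A u v (J x a) (J x b) = -A u v a b := fun u v ↦
    (isParallel_antiInvariant hJ).secondDeriv_mem hD2 hτ hτJ x u v
  have hK : ∀ u v, A (J x u) (J x v) - A (J x v) (J x u) = A u v - A v u := hT2 τ hτ x
  -- Q is the curvature acting on τ. Applying J to all four arguments leaves the curvature unchanged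
  -- (type (1,1)) and negates τ, so Q changes sign.
  let Q : TangentSpace I x → TangentSpace I x → TangentSpace I x → TangentSpace I x → W x :=
    fun u v a b ↦ (A u v - A v u) a b
  have hQ : ∀ u v a b, Q (J x u) (J x v) (J x a) (J x b) = -Q u v a b := by
    intro u v a b
    simp only [Q, hK]
    simp only [sub_apply, hA]
    abel
  have h1 : ∀ j, ∑ i, Q (e j) (e i) (e i) (e j) = ∑ i, Q (e j) (J x (e i)) (J x (e i)) (e j) :=
    fun j ↦ hJ.sum_orthonormal_eq (LinearMap.mk₂ ℝ (fun u v ↦ Q (e j) u v (e j))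
      (fun _ _ _ ↦ by simp only [Q, ContinuousLinearMap.map_add, add_apply, sub_apply]; abel)
      (fun _ _ _ ↦ by simp only [Q, ContinuousLinearMap.map_smul, smul_apply, sub_apply, smul_sub])
      (fun _ _ _ ↦ by simp only [Q, ContinuousLinearMap.map_add, add_apply, sub_apply]; abel)
      (fun _ _ _ ↦ by simp only [Q, ContinuousLinearMap.map_smul, smul_apply, sub_apply, smul_sub]))
  have h2 : ∀ i, ∑ j, Q (e j) (J x (e i)) (J x (e i)) (e j) =
      ∑ j, Q (J x (e j)) (J x (e i)) (J x (e i)) (J x (e j)) :=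
    fun i ↦ hJ.sum_orthonormal_eq (LinearMap.mk₂ ℝ (fun u v ↦ Q u (J x (e i)) (J x (e i)) v)
      (fun _ _ _ ↦ by simp only [Q, ContinuousLinearMap.map_add, add_apply, sub_apply]; abel)
      (fun _ _ _ ↦ by simp only [Q, ContinuousLinearMap.map_smul, smul_apply, sub_apply, smul_sub])
      (fun _ _ _ ↦ by simp only [Q, ContinuousLinearMap.map_add, sub_apply]; abel)
      (fun _ _ _ ↦ by simp only [Q, ContinuousLinearMap.map_smul, sub_apply, smul_sub]))
  -- Rotating e_i and then e_j by J preserves the contraction, whereas by `hQ` it reverses its sign.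
  have h3 : ∑ j, ∑ i, Q (e j) (e i) (e i) (e j) = -∑ j, ∑ i, Q (e j) (e i) (e i) (e j) := by
    calc ∑ j, ∑ i, Q (e j) (e i) (e i) (e j)
        = ∑ i, ∑ j, Q (e j) (J x (e i)) (J x (e i)) (e j) := by
          simp only [h1]; rw [Finset.sum_comm]
      _ = ∑ i, ∑ j, -Q (e j) (e i) (e i) (e j) := by simp only [h2, hQ]
      _ = -∑ j, ∑ i, Q (e j) (e i) (e i) (e j) := by
          rw [Finset.sum_comm]; simp only [Finset.sum_neg_distrib]
  have h4 : ∑ j, ∑ i, Q (e j) (e i) (e i) (e j) = 0 := by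
    have h5 : (2 : ℝ) • ∑ j, ∑ i, Q (e j) (e i) (e i) (e j) = 0 := by
      rw [two_smul]; nth_rw 2 [h3]; exact add_neg_cancel _
    exact (smul_eq_zero.1 h5).resolve_left two_ne_zero
  simp only [Q, sub_apply, Finset.sum_sub_distrib] at h4
  exact sub_eq_zero.1 h4

/-- Exchanging the derivatives costs nothing by `IsKaehler.sum_secondDeriv_comm`, while exchanging
the form slots costs a sign, so the double divergence equals its own negative. -/
theorem IsKaehler.divHom_divHom_eq_zero (hJ : IsKaehler J) (hD : IsSmoothConnection D)
    (hDJ : IsTypeOneOne D J) {τ : Π x : M, TangentSpace I x →L[ℝ] TangentSpace I x →L[ℝ] W x}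
    (hτ : IsSmoothSection I (E →L[ℝ] E →L[ℝ] F) τ) (hτJ : ∀ x, τ x ∈ antiInvariant W J x)
    (hτa : ∀ x, τ x ∈ alternating W x) (x : M) :
    divHom D (divHom (homCov (leviCivita I M) D) τ) x = 0 := by
  have hlc := isSmoothConnection_leviCivita (I := I) (M := M)
  have hD2 := isSmoothConnection_homCov hlc (isSmoothConnection_homCov hlc hD)
  have hA : ∀ u v a b, secondDeriv (homCov (leviCivita I M) (homCov (leviCivita I M) D)) τ x u v a b
      = -secondDeriv (homCov (leviCivita I M) (homCov (leviCivita I M) D)) τ x u v b a := fun u v ↦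
    isParallel_alternating.secondDeriv_mem hD2 hτ hτa x u v
  have h1 := divHom_divHom hD hτ x
  have h2 : divHom D (divHom (homCov (leviCivita I M) D) τ) x =
      -divHom D (divHom (homCov (leviCivita I M) D) τ) x := by
    conv_lhs => rw [h1]
    conv_rhs => rw [h1, hJ.sum_secondDeriv_comm hD hDJ hτ hτJ, Finset.sum_comm]
    rw [← Finset.sum_neg_distrib]
    refine Finset.sum_congr rfl fun j _ ↦ ?_
    rw [← Finset.sum_neg_distrib]
    exact Finset.sum_congr rfl fun i _ ↦ hA _ _ _ _
  have h5 : (2 : ℝ) • divHom D (divHom (homCov (leviCivita I M) D) τ) x = 0 := by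
    rw [two_smul]; nth_rw 2 [h2]; exact add_neg_cancel _
  exact (smul_eq_zero.1 h5).resolve_left two_ne_zero

end Divergence

set_option maxSynthPendingDepth 3

/-! ### The brackets in terms of ∇h, and the perturbed bracket as a divergence. -/

section Bracket
variable {E : Type*} [NormedAddCommGroup E] [NormedSpace ℝ E] [FiniteDimensional ℝ E]
  [CompleteSpace E]
  {H : Type*} [TopologicalSpace H] {I : ModelWithCorners ℝ E H}
  {M : Type*} [TopologicalSpace M] [ChartedSpace H M] [IsManifold I ∞ M] [T2Space M]
  [RiemannianBundle (fun x : M ↦ TangentSpace I x)]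
  [IsContMDiffRiemannianBundle I ∞ E (fun x : M ↦ TangentSpace I x)]
  {J h k : EndField I M}

theorem nablaEnd_apply (hk : IsSmoothEnd k) {Y : Π x : M, TangentSpace I x}
    (hY : IsSmoothSection I E Y) (x : M) (v : TangentSpace I x) :
    nablaEnd k x v (Y x) = leviCivita I M (fun y ↦ k y (Y y)) x v - k x (leviCivita I M Y x v) :=
  homCov_apply (cov := leviCivita I M) (D := leviCivita I M) hk hY x v

/-- Differentiate g(kX, Y) = g(X, kY) using metric compatibility. -/
theorem nablaEnd_symm (hk : k ∈ symTensors I M) (x : M) (w u v : TangentSpace I x) :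
    inner ℝ (nablaEnd k x w u) v = inner ℝ u (nablaEnd k x w v) := by
  obtain ⟨X, hX, rfl⟩ := exists_vectorField x u
  obtain ⟨Y, hY, rfl⟩ := exists_vectorField x v
  have hs : IsSmoothSection I (E →L[ℝ] E) k := hk.1
  have h1 := mvfderiv_inner (hs.apply hX) hY x w
  have h2 := mvfderiv_inner hX (hs.apply hY) x w
  simp only [hk.2] at h1
  rw [nablaEnd_apply hk.1 hX, nablaEnd_apply hk.1 hY, inner_sub_left, inner_sub_right, hk.2,
    ← hk.2 x (leviCivita I M X x w)] at *
  rw [hk.2] at h2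
  rw [hk.2]
  linarith

theorem nablaEnd_anticomm (hJ : IsKaehler J) (hh : h ∈ symMinus J) (x : M)
    (w u : TangentSpace I x) : nablaEnd h x w (J x u) = -J x (nablaEnd h x w u) := by
  obtain ⟨X, hX, rfl⟩ := exists_vectorField x u
  have hs : IsSmoothSection I (E →L[ℝ] E) h := hh.1.1
  have hJs : IsSmoothSection I (E →L[ℝ] E) J := hJ.smooth
  have h1 := nablaEnd_apply hh.1.1 (hJs.apply hX) x w
  have h2 : (fun y ↦ h y (J y (X y))) = fun y ↦ -J y (h y (X y)) := funext fun y ↦ hh.2 y _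
  rw [h1, h2, covariantDerivative_neg (hJs.apply (hs.apply hX)), neg_apply,
    hJ.leviCivita_apply (hs.apply hX), hJ.leviCivita_apply hX, hh.2, nablaEnd_apply hh.1.1 hX,
    map_sub]
  abel

theorem isSmoothEnd_compEnd (hJ : IsSmoothEnd J) (hh : IsSmoothEnd h) :
    IsSmoothEnd (compEnd J h) :=
  IsSmoothSection.of_apply fun X hX ↦ IsSmoothSection.apply (σ := J) hJ
    (IsSmoothSection.apply (σ := h) hh hX)

theorem nablaEnd_compEnd (hJ : IsKaehler J) (hh : IsSmoothEnd h) (x : M)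
    (w u : TangentSpace I x) : nablaEnd (compEnd J h) x w u = J x (nablaEnd h x w u) := by
  obtain ⟨X, hX, rfl⟩ := exists_vectorField x u
  have hs : IsSmoothSection I (E →L[ℝ] E) h := hh
  rw [nablaEnd_apply (isSmoothEnd_compEnd hJ.smooth hh) hX, nablaEnd_apply hh hX, map_sub]
  exact congrArg (· - _) (hJ.leviCivita_apply (hs.apply hX) x w)

theorem compEnd_mem_symTensors (hJ : IsKaehler J) (hh : h ∈ symMinus J) :
    compEnd J h ∈ symTensors I M := by
  refine ⟨isSmoothEnd_compEnd hJ.smooth hh.1.1, fun x u v ↦ ?_⟩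
  change inner ℝ (J x (h x u)) v = inner ℝ u (J x (h x v))
  rw [hJ.inner_apply_left, hh.1.2, hh.2, inner_neg_right, neg_neg]

theorem divEnd_compEnd (hJ : IsKaehler J) (hh : IsSmoothEnd h) (x : M) :
    divEnd (compEnd J h) x = J x (divEnd h x) := by
  simp only [divEnd, nablaEnd_compEnd hJ hh, map_neg, map_sum]

/-- The Frölicher–Nijenhuis bracket in terms of the Levi-Civita connection. -/
theorem fnBracket_eq (hh : IsSmoothEnd h) (x : M) (u v : TangentSpace I x) :
    fnBracket h x u v = h x (nablaEnd h x u v) - h x (nablaEnd h x v u)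
      - nablaEnd h x (h x u) v + nablaEnd h x (h x v) u := by
  obtain ⟨X, hX, rfl⟩ := exists_vectorField x u
  obtain ⟨Y, hY, rfl⟩ := exists_vectorField x v
  have hs : IsSmoothSection I (E →L[ℝ] E) h := hh
  -- Without torsion each Lie bracket is a difference of covariant derivatives; the derivatives of X
  -- and Y themselves then cancel.
  rw [fnBracket_apply (hs.mdifferentiableAt x) (hX.mdifferentiableAt x) (hY.mdifferentiableAt x),
    ← leviCivita_sub_swap hX hY, ← leviCivita_sub_swap (hs.apply hX) hY,
    ← leviCivita_sub_swap hX (hs.apply hY), ← leviCivita_sub_swap (hs.apply hX) (hs.apply hY)]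
  simp only [nablaEnd_apply hh hX, nablaEnd_apply hh hY, map_sub, map_add]
  abel

/-- The Kodaira–Spencer bracket in terms of the Levi-Civita connection. -/
theorem ksBracket_eq (hJ : IsKaehler J) (hh : h ∈ symMinus J) (x : M) (u v : TangentSpace I x) :
    ksBracket J h x u v = (1 / 2 : ℝ) • (-nablaEnd h x (h x u) v + nablaEnd h x (h x v) u
      + J x (nablaEnd h x (J x (h x u)) v) - J x (nablaEnd h x (J x (h x v)) u)) := by
  rw [ksBracket, minusPart_apply, antiPart_apply, antiPart_apply]
  -- Both h and ∇_w h anticommute with J, so the compositions h∘∇_w h commute with J and are killed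
  -- by the projections. Only derivatives in the directions hu, hv, Jhu, Jhv survive.
  simp only [fnBracket_eq hh.1.1, hh.2, nablaEnd_anticomm hJ hh, hJ.sq, map_neg, neg_apply, map_sub,
    map_add, map_smul]
  module

/-- `(w, u, v) ↦ g(kw, u) kv - g(kw, v) ku`. -/
def wedgeTensor (k : EndField I M) (x : M) : TangentSpace I x →L[ℝ] TangentSpace I x →L[ℝ]
    TangentSpace I x →L[ℝ] TangentSpace I x :=
  LinearMap.toContinuousLinearMap
    { toFun := fun w ↦ (innerSL ℝ (k x w)).smulRight (k x) -
        ((innerSL ℝ (k x w)).smulRight (k x)).flip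
      map_add' := fun w w' ↦ by ext u v; simp [add_smul]; abel
      map_smul' := fun c w ↦ by ext u v; simp [mul_smul, smul_sub] }

theorem wedgeTensor_apply (x : M) (w u v : TangentSpace I x) :
    wedgeTensor k x w u v = inner ℝ (k x w) u • k x v - inner ℝ (k x w) v • k x u := rfl

theorem isSmoothSection_wedgeTensor (hk : IsSmoothEnd k) :
    IsSmoothSection I (E →L[ℝ] E →L[ℝ] E →L[ℝ] E) (wedgeTensor k) := by
  have hs : IsSmoothSection I (E →L[ℝ] E) k := hk
  refine IsSmoothSection.of_apply fun A hA ↦ IsSmoothSection.of_apply fun X hX ↦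
    IsSmoothSection.of_apply fun Y hY ↦ ?_
  simp only [wedgeTensor_apply]
  exact (IsSmoothSection.smul ((hs.apply hA).inner hX) (hs.apply hY)).sub
    (IsSmoothSection.smul ((hs.apply hA).inner hY) (hs.apply hX))

theorem leviCivita_smul {f : M → ℝ} (hf : ContMDiff I 𝓘(ℝ) ∞ f) {Y : Π x : M, TangentSpace I x}
    (hY : IsSmoothSection I E Y) (x : M) (v : TangentSpace I x) :
    leviCivita I M (fun y ↦ f y • Y y) x v = f x • leviCivita I M Y x v + d% f x v • Y x := by
  have h1 := (leviCivita I M).isCovariantDerivativeOnUniv.leibniz (hY.mdifferentiableAt x)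
    ((hf x).mdifferentiableAt (by simp))
  exact congrArg (fun A ↦ A v) h1

theorem homCov_wedgeTensor (hk : IsSmoothEnd k) (x : M) (a w u v : TangentSpace I x) :
    homCov (leviCivita I M) (homCov (leviCivita I M) (homCov (leviCivita I M) (leviCivita I M)))
      (wedgeTensor k) x a w u v =
      inner ℝ (nablaEnd k x a w) u • k x v + inner ℝ (k x w) u • nablaEnd k x a v -
      (inner ℝ (nablaEnd k x a w) v • k x u + inner ℝ (k x w) v • nablaEnd k x a u) := by
  obtain ⟨A, hA, rfl⟩ := exists_vectorField x w
  obtain ⟨X, hX, rfl⟩ := exists_vectorField x u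
  obtain ⟨Y, hY, rfl⟩ := exists_vectorField x v
  have hs : IsSmoothSection I (E →L[ℝ] E) k := hk
  have hw := isSmoothSection_wedgeTensor hk
  have h1 := homCov_homCov_apply (D := homCov (leviCivita I M) (leviCivita I M)) hw hA hX x a
  have h2 := homCov_apply (cov := leviCivita I M) (D := leviCivita I M)
    ((hw.apply hA).apply hX) hY x a
  have hf1 := (hs.apply hA).inner hX
  have hf2 := (hs.apply hA).inner hY
  rw [h1, sub_apply, sub_apply, h2]
  simp only [wedgeTensor_apply]
  rw [covariantDerivative_sub (IsSmoothSection.smul hf1 (hs.apply hY))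
    (IsSmoothSection.smul hf2 (hs.apply hX)), sub_apply, leviCivita_smul hf1 (hs.apply hY),
    leviCivita_smul hf2 (hs.apply hX), mvfderiv_inner (hs.apply hA) hX,
    mvfderiv_inner (hs.apply hA) hY, nablaEnd_apply hk hA, nablaEnd_apply hk hX,
    nablaEnd_apply hk hY]
  simp only [inner_sub_left, smul_sub, sub_smul, add_smul]
  abel

/-- Leibniz: differentiating the contracted factor produces δk ∧ k, and in the remaining terms
symmetry of k gives ∑ g(k e_i, a) ∇_{e_i}k = ∇_{ka}k. -/
theorem divHom_wedgeTensor (hk : k ∈ symTensors I M) (x : M) (u v : TangentSpace I x) :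
    divHom (homCov (leviCivita I M) (homCov (leviCivita I M) (leviCivita I M))) (wedgeTensor k) x
      u v = wedge (divEnd k) k x u v - nablaEnd k x (k x u) v + nablaEnd k x (k x v) u := by
  have h1 : ∀ a b : TangentSpace I x, ∑ i,
      inner ℝ (k x (stdOrthonormalBasis ℝ (TangentSpace I x) i)) a •
        nablaEnd k x (stdOrthonormalBasis ℝ (TangentSpace I x) i) b = nablaEnd k x (k x a) b := by
    intro a b
    conv_rhs => rw [← (stdOrthonormalBasis ℝ (TangentSpace I x)).sum_repr' (k x a)]
    simp [hk.2]
  rw [divHom, metricTrace, wedge_apply, ← h1 u v, ← h1 v u]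
  simp only [neg_apply, sum_apply, homCov_wedgeTensor hk.1, divEnd, inner_neg_left, sum_inner,
    Finset.sum_sub_distrib, Finset.sum_add_distrib, ← Finset.sum_smul]
  module

/-- The section of `Hom(TM, Hom(TM, End(TM)))` whose divergence is twice the perturbed
Kodaira–Spencer bracket. -/
def potential (J h : EndField I M) (x : M) : TangentSpace I x →L[ℝ] TangentSpace I x →L[ℝ]
    TangentSpace I x →L[ℝ] TangentSpace I x :=
  wedgeTensor h x - wedgeTensor (compEnd J h) x

theorem isSmoothSection_potential (hJ : IsKaehler J) (hh : h ∈ symMinus J) :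
    IsSmoothSection I (E →L[ℝ] E →L[ℝ] E →L[ℝ] E) (potential J h) :=
  (isSmoothSection_wedgeTensor hh.1.1).sub
    (isSmoothSection_wedgeTensor (compEnd_mem_symTensors hJ hh).1)

/-- The key identity, which explains the perturbation: the wedge terms are exactly what [h,h]^c
lacks to be ½ δΘ. As ∇(Jh) = J∇h, the part from Jh gives the J-terms of `ksBracket_eq`. -/
theorem ksBracketTT_eq (hJ : IsKaehler J) (hh : h ∈ symMinus J) : ksBracketTT J h = fun x ↦
    (1 / 2 : ℝ) • divHom (homCov (leviCivita I M) (homCov (leviCivita I M) (leviCivita I M)))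
      (potential J h) x := by
  have hk := compEnd_mem_symTensors hJ hh
  ext x u v
  have h1 := covariantDerivative_sub (D := homCov (leviCivita I M)
    (homCov (leviCivita I M) (homCov (leviCivita I M) (leviCivita I M))))
    (isSmoothSection_wedgeTensor hh.1.1) (isSmoothSection_wedgeTensor hk.1) x
  have h2 : divHom (homCov (leviCivita I M) (homCov (leviCivita I M) (leviCivita I M)))
      (potential J h) x u v =
      divHom (homCov (leviCivita I M) (homCov (leviCivita I M) (leviCivita I M)))
        (wedgeTensor h) x u v -
      divHom (homCov (leviCivita I M) (homCov (leviCivita I M) (leviCivita I M)))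
        (wedgeTensor (compEnd J h)) x u v := by
    simp only [divHom, metricTrace]
    change (-∑ i, homCov (leviCivita I M) (homCov (leviCivita I M) (homCov (leviCivita I M)
      (leviCivita I M))) (fun y ↦ wedgeTensor h y - wedgeTensor (compEnd J h) y) x _ _) u v = _
    rw [h1]
    simp only [neg_apply, sum_apply, sub_apply, Finset.sum_sub_distrib]
    abel
  rw [smul_apply, smul_apply, h2, divHom_wedgeTensor hh.1, divHom_wedgeTensor hk]
  change ksBracket J h x u v + (1 / 2 : ℝ) • (wedge (divEnd h) h x u v -
    wedge (divEnd (compEnd J h)) (compEnd J h) x u v) = _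
  rw [ksBracket_eq hJ hh]
  simp only [nablaEnd_compEnd hJ hh.1.1]
  change _ = (1 / 2 : ℝ) • (_ - (_ - J x (nablaEnd h x (J x (h x u)) v) +
    J x (nablaEnd h x (J x (h x v)) u)))
  module

end Bracket

/-! ### Symmetries of the potential and of the perturbed bracket; the three assertions. -/

section Main
variable {E : Type*} [NormedAddCommGroup E] [NormedSpace ℝ E] [FiniteDimensional ℝ E]
  [CompleteSpace E]
  {H : Type*} [TopologicalSpace H] {I : ModelWithCorners ℝ E H}
  {M : Type*} [TopologicalSpace M] [ChartedSpace H M] [IsManifold I ∞ M] [T2Space M]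
  [RiemannianBundle (fun x : M ↦ TangentSpace I x)]
  [IsContMDiffRiemannianBundle I ∞ E (fun x : M ↦ TangentSpace I x)]
  {J h k : EndField I M}

/-- The bilinear maps `B : TM × TM → TM` with `B(u, Jv) = -J B(u, v)`. -/
def conjLinearRight (J : EndField I M) (x : M) :
    Submodule ℝ (TangentSpace I x →L[ℝ] TangentSpace I x →L[ℝ] TangentSpace I x) where
  carrier := {B | ∀ u v, B u (J x v) = -J x (B u v)}
  add_mem' ha hb u v := by simp only [add_apply, ha u v, hb u v, map_add]; abel
  zero_mem' u v := by simp
  smul_mem' c B hB u v := by simp only [smul_apply, hB u v, map_smul, smul_neg]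

theorem isParallel_conjLinearRight (hJ : IsKaehler J) :
    IsParallel (homCov (leviCivita I M) (homCov (leviCivita I M) (leviCivita I M)))
      (conjLinearRight J) := by
  intro τ hτ hP x w u v
  obtain ⟨X, hX, rfl⟩ := exists_vectorField x u
  obtain ⟨Y, hY, rfl⟩ := exists_vectorField x v
  have hJs : IsSmoothSection I (E →L[ℝ] E) J := hJ.smooth
  have hXY := (hτ.apply hX).apply hY
  have h1 := homCov_homCov_apply (D := leviCivita I M) hτ hX (hJs.apply hY) x w
  have h2 : (fun y ↦ τ y (X y) (J y (Y y))) = fun y ↦ -J y (τ y (X y) (Y y)) :=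
    funext fun y ↦ hP y _ _
  rw [h1, h2, homCov_homCov_apply hτ hX hY, hJ.leviCivita_apply hY, hP x, hP x,
    covariantDerivative_neg (hJs.apply hXY), neg_apply, hJ.leviCivita_apply hXY, map_sub, map_sub]
  abel

/-- The `End(TM)`-valued bilinear maps `B` with `g(B(a,b)u, v) = g(B(b,a)v, u)`. -/
def pairSymmetric (x : M) : Submodule ℝ (TangentSpace I x →L[ℝ] TangentSpace I x →L[ℝ]
    TangentSpace I x →L[ℝ] TangentSpace I x) where
  carrier := {B | ∀ a b u v, inner ℝ (B a b u) v = inner ℝ (B b a v) u}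
  add_mem' ha hb a b u v := by
    simp only [add_apply, inner_add_left, ha a b u v, hb a b u v]
  zero_mem' a b u v := by simp
  smul_mem' c B hB a b u v := by simp only [smul_apply, inner_smul_left, hB a b u v]

/-- The symmetry involves only the metric, which is parallel. In `key` the swap (a,u) ↔ (b,v) fixes
the differentiated function and permutes the four correction terms. -/
theorem isParallel_pairSymmetric :
    IsParallel (homCov (leviCivita I M) (homCov (leviCivita I M)
      (homCov (leviCivita I M) (leviCivita I M)))) (pairSymmetric (I := I) (M := M)) := by
  intro τ hτ hP x w a b u v
  obtain ⟨A, hA, rfl⟩ := exists_vectorField x a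
  obtain ⟨B, hB, rfl⟩ := exists_vectorField x b
  obtain ⟨X, hX, rfl⟩ := exists_vectorField x u
  obtain ⟨Y, hY, rfl⟩ := exists_vectorField x v
  have key : ∀ {A B X Y : Π x : M, TangentSpace I x}, IsSmoothSection I E A →
      IsSmoothSection I E B → IsSmoothSection I E X → IsSmoothSection I E Y →
      inner ℝ (homCov (leviCivita I M) (homCov (leviCivita I M)
        (homCov (leviCivita I M) (leviCivita I M))) τ x w (A x) (B x) (X x)) (Y x) =
      d% (fun y ↦ (inner ℝ (τ y (A y) (B y) (X y)) (Y y) : ℝ)) x w -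
        inner ℝ (τ x (A x) (B x) (X x)) (leviCivita I M Y x w) -
        inner ℝ (τ x (A x) (B x) (leviCivita I M X x w)) (Y x) -
        inner ℝ (τ x (leviCivita I M A x w) (B x) (X x)) (Y x) -
        inner ℝ (τ x (A x) (leviCivita I M B x w) (X x)) (Y x) := by
    intro A B X Y hA hB hX hY
    have h1 := homCov_homCov_apply (D := homCov (leviCivita I M) (leviCivita I M)) hτ hA hB x w
    have h2 := homCov_apply (cov := leviCivita I M) (D := leviCivita I M)
      ((hτ.apply hA).apply hB) hX x w
    rw [h1, sub_apply, sub_apply, h2, mvfderiv_inner (((hτ.apply hA).apply hB).apply hX) hY]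
    simp only [inner_sub_left]
    ring
  have hd : (fun y ↦ (inner ℝ (τ y (A y) (B y) (X y)) (Y y) : ℝ)) =
      fun y ↦ (inner ℝ (τ y (B y) (A y) (Y y)) (X y) : ℝ) := funext fun y ↦ hP y _ _ _ _
  rw [key hA hB hX hY, key hB hA hY hX, hd, hP x (A x) (B x) (X x) (leviCivita I M Y x w),
    hP x (A x) (B x) (leviCivita I M X x w), hP x (leviCivita I M A x w),
    hP x (A x) (leviCivita I M B x w)]
  ring

/-- Applying J to u and v negates g(hu,v)hw and g(Jhu,v)Jhw, and turns g(hu,w)hv into -g(-Jhu,w)Jhv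
and vice versa. The minus sign between the two halves of Θ makes this exchange an overall sign. -/
theorem potential_mem_antiInvariant (hJ : IsKaehler J) (hh : h ∈ symMinus J) (x : M) :
    potential J h x ∈ antiInvariant (fun x : M ↦ TangentSpace I x →L[ℝ] TangentSpace I x) J x := by
  intro u v
  ext w
  have h1 : ∀ a, compEnd J h x a = J x (h x a) := fun _ ↦ rfl
  simp only [potential, sub_apply, neg_apply, wedgeTensor_apply, h1, hh.2, map_neg, hJ.sq,
    inner_neg_left, hJ.isometry, neg_neg]
  rw [hJ.inner_apply_left x (h x u) v]
  module

theorem wedgeTensor_mem_pairSymmetric (hk : k ∈ symTensors I M) (x : M) :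
    wedgeTensor k x ∈ pairSymmetric x := by
  intro a b u v
  have e : ∀ p q, inner ℝ (k x p) q = inner ℝ (k x q) p := fun p q ↦ by
    rw [hk.2, real_inner_comm]
  simp only [wedgeTensor_apply, inner_sub_left, inner_smul_left]
  rw [e a b, e u v]
  simp
  ring

theorem potential_mem_pairSymmetric (hJ : IsKaehler J) (hh : h ∈ symMinus J) (x : M) :
    potential J h x ∈ pairSymmetric x :=
  sub_mem (wedgeTensor_mem_pairSymmetric hh.1 x)
    (wedgeTensor_mem_pairSymmetric (compEnd_mem_symTensors hJ hh) x)

theorem ksBracketTT_apply (x : M) (u v : TangentSpace I x) :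
    ksBracketTT J h x u v = ksBracket J h x u v + (1 / 2 : ℝ) • (wedge (divEnd h) h x u v
      - wedge (divEnd (compEnd J h)) (compEnd J h) x u v) := rfl

theorem ksBracketTT_mem_alternating (hJ : IsKaehler J) (hh : h ∈ symMinus J) (x : M) :
    ksBracketTT J h x ∈ alternating (fun x : M ↦ TangentSpace I x) x := by
  intro u v
  simp only [ksBracketTT_apply, ksBracket_eq hJ hh, wedge_apply]
  module

theorem ksBracketTT_mem_conjLinearRight (hJ : IsKaehler J) (hh : h ∈ symMinus J) (x : M) :
    ksBracketTT J h x ∈ conjLinearRight J x := by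
  intro u v
  have h1 : ∀ a, compEnd J h x a = J x (h x a) := fun _ ↦ rfl
  simp only [ksBracketTT_apply, ksBracket_eq hJ hh, wedge_apply, divEnd_compEnd hJ hh.1.1, h1,
    hh.2, nablaEnd_anticomm hJ hh, hJ.sq, map_neg, neg_apply, map_sub, map_add, map_smul,
    hJ.isometry]
  rw [hJ.inner_apply_left x (divEnd h x) v]
  module

/-- Conjugate linearity in the second slot passes to the first by alternation, and then J² = -1. -/
theorem ksBracketTT_mem_antiInvariant (hJ : IsKaehler J) (hh : h ∈ symMinus J) (x : M) :
    ksBracketTT J h x ∈ antiInvariant (fun x : M ↦ TangentSpace I x) J x := by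
  intro u v
  have hc := ksBracketTT_mem_conjLinearRight hJ hh x
  have ha := ksBracketTT_mem_alternating hJ hh x
  rw [hc, ha (J x u), hc, ha v u]
  simp only [map_neg, neg_neg, hJ.sq]

/-- Smoothness is inherited from the potential, so the pointwise definition of the bracket need not
be examined. -/
theorem isSmoothSection_ksBracketTT (hJ : IsKaehler J) (hh : h ∈ symMinus J) :
    IsSmoothSection I (E →L[ℝ] E →L[ℝ] E) (ksBracketTT J h) := by
  have hlc := isSmoothConnection_leviCivita (I := I) (M := M)
  rw [ksBracketTT_eq hJ hh]
  exact IsSmoothSection.const_smul _ (IsSmoothSection.divHom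
    (isSmoothConnection_homCov hlc (isSmoothConnection_homCov hlc hlc))
    (isSmoothSection_potential hJ hh))

theorem inner_divTwo_ksBracketTT (hJ : IsKaehler J) (hh : h ∈ symMinus J) (x : M)
    (u v : TangentSpace I x) :
    inner ℝ (divTwo (ksBracketTT J h) x u) v = inner ℝ u (divTwo (ksBracketTT J h) x v) := by
  have hlc := isSmoothConnection_leviCivita (I := I) (M := M)
  have hD1 := isSmoothConnection_homCov hlc hlc
  have hD2 := isSmoothConnection_homCov hlc hD1
  have hD3 := isSmoothConnection_homCov hlc hD2
  have hΘ := isSmoothSection_potential hJ hh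
  have hA := fun a b ↦ isParallel_pairSymmetric.secondDeriv_mem hD3 hΘ
    (potential_mem_pairSymmetric hJ hh) x a b
  have hc := hJ.sum_secondDeriv_comm hD1 (isTypeOneOne_homCov hlc hJ.isTypeOneOne hJ.isTypeOneOne)
    hΘ (potential_mem_antiInvariant hJ hh) x
  have h1 : divTwo (ksBracketTT J h) x = (1 / 2 : ℝ) •
      divHom (homCov (leviCivita I M) (leviCivita I M)) (divHom (homCov (leviCivita I M)
        (homCov (leviCivita I M) (leviCivita I M))) (potential J h)) x := by
    rw [ksBracketTT_eq hJ hh]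
    exact divHom_const_smul (IsSmoothSection.divHom hD2 hΘ) _ x
  have h2 := divHom_divHom hD1 hΘ x
  rw [real_inner_comm _ u, h1, smul_apply, smul_apply, inner_smul_left, inner_smul_left]
  congr 1
  -- One side has its indices exchanged, the other its derivatives commuted; the summands then match
  -- by the pair symmetry of ∇²Θ.
  conv_lhs => rw [h2, Finset.sum_comm]
  conv_rhs => rw [h2, hc]
  simp only [sum_apply, sum_inner]
  exact Finset.sum_congr rfl fun i _ ↦ Finset.sum_congr rfl fun j _ ↦ hA _ _ _ _ _ _

theorem divTwo_ksBracketTT_anticomm (hJ : IsKaehler J) (hh : h ∈ symMinus J) (x : M)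
    (u : TangentSpace I x) :
    divTwo (ksBracketTT J h) x (J x u) = -J x (divTwo (ksBracketTT J h) x u) := by
  have h1 : ∀ a b c, nablaTwo (ksBracketTT J h) x a b (J x c) =
      -J x (nablaTwo (ksBracketTT J h) x a b c) := fun a ↦
    isParallel_conjLinearRight hJ _ (isSmoothSection_ksBracketTT hJ hh)
      (ksBracketTT_mem_conjLinearRight hJ hh) x a
  simp only [divTwo, neg_apply, sum_apply, h1, map_neg, map_sum, Finset.sum_neg_distrib]

/-- Cyclicity of the trace: tr(AJ·J) = -tr A and tr(J·AJ) = tr A. -/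
theorem trace_eq_zero_of_anticomm (hJ : IsKaehler J) (x : M)
    (A : TangentSpace I x →ₗ[ℝ] TangentSpace I x) (hA : ∀ u, A (J x u) = -J x (A u)) :
    LinearMap.trace ℝ (TangentSpace I x) A = 0 := by
  have h2 := LinearMap.trace_mul_comm ℝ (A * (J x : TangentSpace I x →ₗ[ℝ] TangentSpace I x))
    (J x : TangentSpace I x →ₗ[ℝ] TangentSpace I x)
  have h3 : A * (J x : TangentSpace I x →ₗ[ℝ] TangentSpace I x) *
      (J x : TangentSpace I x →ₗ[ℝ] TangentSpace I x) = -A := by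
    ext u
    simp [hJ.sq]
  have h4 : (J x : TangentSpace I x →ₗ[ℝ] TangentSpace I x) *
      (A * (J x : TangentSpace I x →ₗ[ℝ] TangentSpace I x)) = A := by
    ext u
    simp [hA, hJ.sq]
  rw [h3, h4, map_neg] at h2
  linarith

theorem divTwo_ksBracketTT_mem (hJ : IsKaehler J) (hh : h ∈ symMinus J) :
    divTwo (ksBracketTT J h) ∈ ttMinus J := by
  have hlc := isSmoothConnection_leviCivita (I := I) (M := M)
  have hα := isSmoothSection_ksBracketTT hJ hh
  have hsym : divTwo (ksBracketTT J h) ∈ symTensors I M :=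
    ⟨IsSmoothSection.divHom (isSmoothConnection_homCov hlc hlc) hα,
      inner_divTwo_ksBracketTT hJ hh⟩
  -- `divEnd` and `divTwo` unfold to `divHom` for the connections on TM and End(TM), so δδα = 0 is
  -- the general statement with W = TM.
  exact ⟨⟨hsym, hJ.divHom_divHom_eq_zero hlc hJ.isTypeOneOne hα
    (ksBracketTT_mem_antiInvariant hJ hh) (ksBracketTT_mem_alternating hJ hh),
    fun x ↦ trace_eq_zero_of_anticomm hJ x _ (divTwo_ksBracketTT_anticomm hJ hh x)⟩, hsym,
    divTwo_ksBracketTT_anticomm hJ hh⟩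

/-- Both ∇_a h and J∇_a h are g-symmetric, so for each of the directions hu, Jhu and their cyclic
analogues the two terms in the cyclic sum cancel. -/
theorem totalAntisymm_ksBracket (hJ : IsKaehler J) (hh : h ∈ symMinus J) (x : M)
    (u v w : TangentSpace I x) : totalAntisymm (ksBracket J h) x u v w = 0 := by
  have h1 := nablaEnd_symm hh.1 x
  have h2 : ∀ a b c, inner ℝ (J x (nablaEnd h x a b)) c = inner ℝ (J x (nablaEnd h x a c)) b := by
    intro a b c
    rw [hJ.inner_apply_left, h1, nablaEnd_anticomm hJ hh, inner_neg_right, neg_neg,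
      real_inner_comm]
  have h3 : ∀ a b c, inner ℝ (nablaEnd h x a b) c = inner ℝ (nablaEnd h x a c) b := by
    intro a b c
    rw [h1, real_inner_comm]
  simp only [totalAntisymm, ksBracket_eq hJ hh, inner_smul_left, inner_add_left, inner_sub_left,
    inner_neg_left]
  rw [h3 (h x u) v w, h3 (h x v) u w, h3 (h x w) v u, h2 _ v w, h2 _ u w, h2 (J x (h x w)) v u]
  ring

/-- Each coefficient g(V, ·) multiplies a difference such as g(kv,w) - g(kw,v), which is zero by
symmetry of k. -/
theorem totalAntisymm_wedge (hk : k ∈ symTensors I M) (V : Π x : M, TangentSpace I x) (x : M)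
    (u v w : TangentSpace I x) : totalAntisymm (wedge V k) x u v w = 0 := by
  have e : ∀ p q, inner ℝ (k x p) q = inner ℝ (k x q) p := fun p q ↦ by
    rw [hk.2, real_inner_comm]
  simp only [totalAntisymm, wedge_apply, inner_sub_left, inner_smul_left]
  rw [e v w, e u w, e u v]
  simp

theorem totalAntisymm_ksBracketTT (hJ : IsKaehler J) (hh : h ∈ symMinus J) (x : M)
    (u v w : TangentSpace I x) : totalAntisymm (ksBracketTT J h) x u v w = 0 := by
  have h1 := totalAntisymm_ksBracket hJ hh x u v w
  have h2 := totalAntisymm_wedge hh.1 (divEnd h) x u v w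
  have h3 := totalAntisymm_wedge (compEnd_mem_symTensors hJ hh) (divEnd (compEnd J h)) x u v w
  simp only [totalAntisymm, ksBracketTT_apply, inner_add_left, inner_smul_left, inner_sub_left]
    at h1 h2 h3 ⊢
  linear_combination h1 + (starRingEnd ℝ) (1 / 2) * (h2 - h3)

theorem ksBracketTT_eq_ksBracket (hJ : IsKaehler J) (hh : h ∈ symMinus J)
    (hδ : ∀ x : M, divEnd h x = 0) : ksBracketTT J h = ksBracket J h := by
  ext x u v
  rw [ksBracketTT_apply, wedge_apply, wedge_apply, divEnd_compEnd hJ hh.1.1, hδ]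
  simp

end Main

end KaehlerBracket

end

theorem mainTheorem6 (m : ℕ) {M : Type*} [TopologicalSpace M] [T2Space M] [SigmaCompactSpace M]
    [ChartedSpace (EuclideanSpace ℝ (Fin (2 * m))) M] [IsManifold (𝓡 (2 * m)) ∞ M]
    [RiemannianBundle (fun x : M ↦ TangentSpace (𝓡 (2 * m)) x)]
    [IsContMDiffRiemannianBundle (𝓡 (2 * m)) ∞ (EuclideanSpace ℝ (Fin (2 * m)))
      (fun x : M ↦ TangentSpace (𝓡 (2 * m)) x)]
    (J : KaehlerBracket.EndField (𝓡 (2 * m)) M) (hJ : KaehlerBracket.IsKaehler J)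
    (c : ℝ) (hc : c < 0) (hEinstein : KaehlerBracket.IsEinstein (𝓡 (2 * m)) M c)
    (h : KaehlerBracket.EndField (𝓡 (2 * m)) M) (hh : h ∈ KaehlerBracket.symMinus J) :
    KaehlerBracket.divTwo (KaehlerBracket.ksBracketTT J h) ∈ KaehlerBracket.ttMinus J ∧
    (∀ (x : M) (X Y Z : TangentSpace (𝓡 (2 * m)) x),
      KaehlerBracket.totalAntisymm (KaehlerBracket.ksBracket J h) x X Y Z = 0) ∧
    (∀ (x : M) (X Y Z : TangentSpace (𝓡 (2 * m)) x),
      KaehlerBracket.totalAntisymm (KaehlerBracket.ksBracketTT J h) x X Y Z = 0) ∧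
    ((∀ x : M, KaehlerBracket.divEnd h x = 0) →
      KaehlerBracket.divTwo (KaehlerBracket.ksBracket J h) ∈ KaehlerBracket.ttMinus J) := by
  refine ⟨KaehlerBracket.divTwo_ksBracketTT_mem hJ hh,
    KaehlerBracket.totalAntisymm_ksBracket hJ hh, KaehlerBracket.totalAntisymm_ksBracketTT hJ hh,
    fun hδ ↦ ?_⟩
  rw [← KaehlerBracket.ksBracketTT_eq_ksBracket hJ hh hδ]
  exact KaehlerBracket.divTwo_ksBracketTT_mem hJ hh
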